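/- Let $1\le k\le n-1$ be integers, let $\mathbb S^n\subset\mathbb R^{n+1}$ be the unit sphere with its Riemannian measure $dx$, and let $0:=e_{n+1}$ be its pole, $d$ the geodesic distance. Let $\Xi_k(\mathbb S^n)$ be the set of $k$-dimensional totally geodesic submanifolds $\xi=W\cap\mathbb S^n$, with $W\subset\mathbb R^{n+1}$ a $(k+1)$-dimensional linear subspace, equipped with the measure $$\int_{\Xi_k(\mathbb S^n)}\varphi\,d\xi=C_{n,k}\int_{SO(n)}\int_0^{\pi/2}\varphi(\xi_{g,\theta})\,\sin^{n-k-1}\theta\,\cos^k\theta\,d\theta\,dg ,$$ where $C_{n,k}>0$ is a constant, $dg$ is the Haar measure of $SO(n)$, which acts on the first $n$ coordinates, and $\xi_{g,\theta}$ is the submanifold with $W=\operatorname{span}(ge_1,\dots,ge_k,\ \cos\theta\, e_{n+1}+\sin\theta\, ge_{k+1})$. For $f:\mathbb S^n\to\mathbb C$ let $R_kf(\xi)=\int_\xi f(x)\,d_\xi x$, with $d_\xi x$ the induced Riemannian measure on $\xi$. A function $f$ on $\mathbb S^n$ is radial if $f(x)$ depends only on $\cos d(0,x)$. For $p\ge 1$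 and $\alpha_1,\alpha_2\in\mathbb R$, $L^p_{\alpha_1,\alpha_2}(\mathbb S^n)$ is the space of measurable $f$ with $$\|f\|_{L^p_{\alpha_1,\alpha_2}}=\Big(\int_{\mathbb S^n}|f(x)|^p\,\sin^{\alpha_1}d(0,x)\,|\cos d(0,x)|^{\alpha_2}\,dx\Big)^{1/p}<\infty .$$ **Theorem.** Let $\alpha_1,\alpha_2,\gamma_1,\gamma_2\in\mathbb R$ and $p\ge\max\{1,1+\alpha_2\}$, with $p>1+\alpha_2$ whenever $\alpha_2>0$. Assume further that $\gamma_1>0$ if $p=\frac{\alpha_1+n}{k}$. Consider the statement (I) there is a constant $C\ge0$ such that for every radial $f\in L^p_{\alpha_1,\alpha_2}(\mathbb S^n)$ the transform $R_kf(\xi)$ exists for almost every $\xi$ and $$\big\|\sin^{\gamma_1}d(0,\cdot)\,\cos^{\gamma_2}d(0,\cdot)\,R_kf\big\|_{L^\infty(\Xi_k(\mathbb S^n))}\le C\,\|f\|_{L^p_{\alpha_1,\alpha_2}(\mathbb S^n)},$$ and the condition (II) $\gamma_1\ge\max\big\{0,\frac{\alpha_1+n}{p}-k\big\}$ and $\gamma_2\ge\frac{1+\alpha_2}{p}$.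 (A) If $k\ge2$, then (I) holds if and only if (II) holds. (B) If $k=1$, then (I) holds if and only if (II) holds and $p>2$. -/

import Mathlib

open MeasureTheory Metric Set
open scoped ENNReal NNReal

noncomputable section

namespace KPlane

/-- The ambient Euclidean space `ℝ^{n+1}`. -/
abbrev Amb (n : ℕ) : Type := EuclideanSpace ℝ (Fin (n + 1))

/-- The unit sphere `𝕊^n ⊆ ℝ^{n+1}`. -/
abbrev Sph (n : ℕ) : Type := sphere (0 : Amb n) 1

/-- The Riemannian (surface) measure of `𝕊^n`. -/
def sphMeasure (n : ℕ) : Measure (Sph n) := (volume : Measure (Amb n)).toSphere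

/-- The origin of `𝕊^n`: the pole `e_{n+1}`. -/
def pole (n : ℕ) : Amb n := EuclideanSpace.single (Fin.last n) 1

/-- The geodesic distance `d(0, x)` on the sphere from the pole to `x`. -/
def dist0 {n : ℕ} (x : Amb n) : ℝ := InnerProductGeometry.angle (pole n) x

/-- The `k`-dimensional totally geodesic submanifolds of `𝕊^n`: these are the sets `W ∩ 𝕊^n`
with `W` a `(k+1)`-dimensional linear subspace of `ℝ^{n+1}`, and are represented by `W`. -/
abbrev Xi (n k : ℕ) : Type := {W : Submodule ℝ (Amb n) // Module.finrank ℝ W = k + 1}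

/-- The geodesic distance `d(0, ξ)` from the pole to the totally geodesic submanifold `ξ`. -/
def distXi {n k : ℕ} (ξ : Xi n k) : ℝ := ⨅ y : sphere (0 : ξ.1) 1, dist0 (y.1 : Amb n)

/-- A point of `ξ = W ∩ 𝕊^n`, seen as a point of `𝕊^n`. -/
def Xi.incl {n k : ℕ} (ξ : Xi n k) (y : sphere (0 : ξ.1) 1) : Sph n :=
  ⟨((y : ξ.1) : Amb n), by
    have h := y.2
    rw [mem_sphere_zero_iff_norm] at h ⊢
    exact h⟩

/-- The measure induced by the Riemannian metric on `ξ = W ∩ 𝕊^n`: the surface measure of the unit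
sphere of the Euclidean space `W`. -/
def Xi.inducedMeasure {n k : ℕ} (ξ : Xi n k) : Measure (sphere (0 : ξ.1) 1) :=
  (volume : Measure ξ.1).toSphere

/-- The totally geodesic `k`-plane transform `R_k f (ξ) = ∫_ξ f(x) d_ξ x`. -/
def planeTransform {n : ℕ} (k : ℕ) (f : Sph n → ℂ) (ξ : Xi n k) : ℂ :=
  ∫ y, f (ξ.incl y) ∂ξ.inducedMeasure

/-- `R_k f (ξ)` exists: `f` is integrable on `ξ`. -/
def PlaneTransformExistsAt {n k : ℕ} (f : Sph n → ℂ) (ξ : Xi n k) : Prop :=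
  Integrable (fun y => f (ξ.incl y)) ξ.inducedMeasure

/-- Radial (zonal) functions: `f(x)` is a function of `cos d(0, x)`. -/
def IsRadial {n : ℕ} (f : Sph n → ℂ) : Prop :=
  ∃ g : ℝ → ℂ, ∀ x : Sph n, f x = g (Real.cos (dist0 (x : Amb n)))

/-- The norm of `L^p_{α₁,α₂}(𝕊^n)`:
`(∫ |f(x)|^p sin^{α₁} d(0,x) |cos d(0,x)|^{α₂} dx)^{1/p}`, with value `∞` if the integral
diverges. -/
def wNorm {n : ℕ} (p α₁ α₂ : ℝ) (f : Sph n → ℂ) : ℝ≥0∞ :=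
  (∫⁻ x : Sph n, ‖f x‖ₑ ^ p *
    ENNReal.ofReal (Real.sin (dist0 (x : Amb n)) ^ α₁ * |Real.cos (dist0 (x : Amb n))| ^ α₂)
      ∂sphMeasure n) ^ (1 / p)

/-- Membership in `L^p_{α₁,α₂}(𝕊^n)`. -/
def MemWLp {n : ℕ} (p α₁ α₂ : ℝ) (f : Sph n → ℂ) : Prop :=
  Measurable f ∧ wNorm p α₁ α₂ f < ∞

/-! The measure of the space `Ξ_k(𝕊^n)`. -/

/-- The topology of `Ξ_k(𝕊^n)` (the usual one of the Grassmannian): subspaces are identified with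
the orthogonal projections onto them. -/
instance Xi.topology (n k : ℕ) : TopologicalSpace (Xi n k) :=
  TopologicalSpace.induced (fun ξ => ξ.1.starProjection) inferInstance

instance Xi.measurableSpace (n k : ℕ) : MeasurableSpace (Xi n k) := borel _

instance Xi.borelSpace (n k : ℕ) : BorelSpace (Xi n k) := ⟨rfl⟩

/-- The rotation group `SO(n)`. -/
abbrev Rot (n : ℕ) : Type := Matrix.specialOrthogonalGroup (Fin n) ℝ

instance Rot.measurableSpace (n : ℕ) : MeasurableSpace (Rot n) := borel _

instance Rot.borelSpace (n : ℕ) : BorelSpace (Rot n) := ⟨rfl⟩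

instance Rot.isTopologicalGroup (n : ℕ) : IsTopologicalGroup (Rot n) where
  continuous_mul := by
    refine Continuous.subtype_mk ?_ _
    exact (continuous_subtype_val.comp continuous_fst).mul
      (continuous_subtype_val.comp continuous_snd)
  continuous_inv := by
    refine Continuous.subtype_mk ?_ _
    exact continuous_subtype_val.matrix_conjTranspose

lemma Rot.col_orthonormal {n : ℕ} (γ : Rot n) (j l : Fin n) :
    ∑ i, γ.1 i j * γ.1 i l = if j = l then 1 else 0 := by
  have h := (Matrix.mem_specialOrthogonalGroup_iff.1 γ.2).1
  rw [Matrix.mem_orthogonalGroup_iff'] at h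
  have h2 := congrFun (congrFun h j) l
  simpa [Matrix.mul_apply, Matrix.star_eq_conjTranspose, Matrix.one_apply] using h2

instance Rot.compactSpace (n : ℕ) : CompactSpace (Rot n) := by
  refine isCompact_iff_compactSpace.1 ?_
  have hc : IsCompact (Set.univ.pi fun _ : Fin n => Set.univ.pi fun _ : Fin n =>
      Set.Icc (-1 : ℝ) 1) :=
    isCompact_univ_pi fun _ => isCompact_univ_pi fun _ => isCompact_Icc
  refine IsCompact.of_isClosed_subset (X := Matrix (Fin n) (Fin n) ℝ) hc ?_ ?_
  · have : (SetLike.coe (Matrix.specialOrthogonalGroup (Fin n) ℝ)) =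
        {A : Matrix (Fin n) (Fin n) ℝ | A * star A = 1} ∩ {A | A.det = 1} := by
      ext A
      simp only [SetLike.mem_coe, Matrix.mem_specialOrthogonalGroup_iff,
        Matrix.mem_orthogonalGroup_iff, Set.mem_inter_iff, Set.mem_ofPred_eq,
        Matrix.star_eq_conjTranspose, Matrix.conjTranspose_eq_transpose_of_trivial]
    rw [this]
    refine (isClosed_eq ?_ continuous_const).inter (isClosed_eq ?_ continuous_const)
    · exact continuous_id.mul continuous_id.matrix_conjTranspose
    · exact continuous_id.matrix_det
  · intro A hA i _ j _
    have h := Rot.col_orthonormal ⟨A, hA⟩ j j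
    simp only [if_true] at h
    have h1 : A i j * A i j ≤ ∑ i, A i j * A i j :=
      Finset.single_le_sum (f := fun i => A i j * A i j) (fun i _ => mul_self_nonneg _)
        (Finset.mem_univ i)
    rw [h] at h1
    constructor <;> nlinarith

/-- The normalised Haar measure of `SO(n)`. -/
def Rot.haar (n : ℕ) : Measure (Rot n) :=
  Measure.haarMeasure ⟨⟨Set.univ, isCompact_univ⟩, by simp⟩

/-- The `j`-th vector of the frame of the submanifold `(γ ℝ^k, θ γ e_{k+1})`: the vectors
`γ e_1, …, γ e_k` (with `SO(n)` acting on the first `n` coordinates), which span the tangent space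
at the foot of the perpendicular from the pole, followed by the foot
`cos θ e_{n+1} + sin θ γ e_{k+1}` itself. -/
def frame {n k : ℕ} (hk : k < n) (γ : Rot n) (θ : ℝ) : Fin (k + 1) → Amb n :=
  Fin.snoc (α := fun _ => Amb n)
    (fun j : Fin k => WithLp.toLp 2
      (Fin.snoc (α := fun _ => ℝ) (fun i : Fin n => γ.1 i ⟨j, j.2.trans hk⟩) 0))
    (WithLp.toLp 2
      (Fin.snoc (α := fun _ => ℝ) (fun i : Fin n => Real.sin θ * γ.1 i ⟨k, hk⟩) (Real.cos θ)))

lemma frame_orthonormal {n k : ℕ} (hk : k < n) (γ : Rot n) (θ : ℝ) :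
    Orthonormal ℝ (frame hk γ θ) := by
  rw [orthonormal_iff_ite]
  intro a b
  have H := Rot.col_orthonormal γ
  refine Fin.lastCases ?_ (fun a => ?_) a <;> refine Fin.lastCases ?_ (fun b => ?_) b
  · simp only [frame, Fin.snoc_last, EuclideanSpace.inner_eq_star_dotProduct, dotProduct,
      Fin.sum_univ_castSucc, Fin.snoc_castSucc, star_trivial, Pi.star_apply, if_true]
    have h1 := H ⟨k, hk⟩ ⟨k, hk⟩
    simp only [if_true] at h1
    have h2 : ∑ i, Real.sin θ * γ.1 i ⟨k, hk⟩ * (Real.sin θ * γ.1 i ⟨k, hk⟩) =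
        Real.sin θ ^ 2 * ∑ i, γ.1 i ⟨k, hk⟩ * γ.1 i ⟨k, hk⟩ := by
      rw [Finset.mul_sum]
      exact Finset.sum_congr rfl fun i _ => by ring
    rw [h2, h1]
    nlinarith [Real.sin_sq_add_cos_sq θ]
  · have hb : (b : ℕ) ≠ k := b.2.ne
    simp only [frame, Fin.snoc_last, EuclideanSpace.inner_eq_star_dotProduct, dotProduct,
      Fin.sum_univ_castSucc, Fin.snoc_castSucc, star_trivial, Pi.star_apply]
    have h1 := H ⟨b, b.2.trans hk⟩ ⟨k, hk⟩
    have h2 : ∑ i, γ.1 i ⟨b, b.2.trans hk⟩ * (Real.sin θ * γ.1 i ⟨k, hk⟩) =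
        Real.sin θ * ∑ i, γ.1 i ⟨b, b.2.trans hk⟩ * γ.1 i ⟨k, hk⟩ := by
      rw [Finset.mul_sum]
      exact Finset.sum_congr rfl fun i _ => by ring
    rw [h2, h1]
    simp [hb, (Fin.castSucc_lt_last b).ne']
  · have ha : k ≠ (a : ℕ) := a.2.ne'
    simp only [frame, Fin.snoc_last, EuclideanSpace.inner_eq_star_dotProduct, dotProduct,
      Fin.sum_univ_castSucc, Fin.snoc_castSucc, star_trivial, Pi.star_apply]
    have h1 := H ⟨k, hk⟩ ⟨a, a.2.trans hk⟩
    have h2 : ∑ i, Real.sin θ * γ.1 i ⟨k, hk⟩ * γ.1 i ⟨a, a.2.trans hk⟩ =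
        Real.sin θ * ∑ i, γ.1 i ⟨k, hk⟩ * γ.1 i ⟨a, a.2.trans hk⟩ := by
      rw [Finset.mul_sum]
      exact Finset.sum_congr rfl fun i _ => by ring
    rw [h2, h1]
    simp [ha, (Fin.castSucc_lt_last a).ne]
  · simp only [frame, Fin.snoc_last, EuclideanSpace.inner_eq_star_dotProduct, dotProduct,
      Fin.sum_univ_castSucc, Fin.snoc_castSucc, star_trivial, Pi.star_apply]
    have h1 := H ⟨b, b.2.trans hk⟩ ⟨a, a.2.trans hk⟩
    rw [h1]
    simp [Fin.ext_iff, eq_comm]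

/-- The totally geodesic submanifold at distance `θ` from the pole with tangent directions
`γ ℝ^k` and foot of the perpendicular in the direction `γ e_{k+1}`. -/
def param {n k : ℕ} (hk : k < n) (z : Rot n × ℝ) : Xi n k :=
  ⟨Submodule.span ℝ (Set.range (frame hk z.1 z.2)), by
    rw [finrank_span_eq_card (frame_orthonormal hk z.1 z.2).linearIndependent]
    simp⟩

/-- The measure of `Ξ_k(𝕊^n)`, up to a positive constant factor:
`∫ φ dξ = ∫_{SO(n)} ∫_0^{π/2} φ(γ ℝ^k, θ γ e_{k+1}) sin^{n-k-1} θ cos^k θ dθ dγ`. -/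
def xiMeasure {n k : ℕ} (hk : k < n) : Measure (Xi n k) :=
  Measure.map (param hk) ((Rot.haar n).prod
    ((volume.restrict (Set.Ioo (0 : ℝ) (Real.pi / 2))).withDensity fun θ =>
      ENNReal.ofReal (Real.sin θ ^ (n - k - 1) * Real.cos θ ^ k)))

lemma continuous_param {n k : ℕ} (hk : k < n) : Continuous (param (n := n) hk) := by
  refine continuous_induced_rng.2 ?_
  have hf : ∀ i, Continuous fun z : Rot n × ℝ => frame hk z.1 z.2 i := by
    have hγ : ∀ i l, Continuous fun z : Rot n × ℝ => z.1.1 i l := fun i l =>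
      (continuous_subtype_val.comp continuous_fst).matrix_elem i l
    intro i
    refine Fin.lastCases ?_ (fun j => ?_) i
    · simp only [frame, Fin.snoc_last]
      refine (PiLp.continuous_toLp 2 _).comp (continuous_pi fun l => ?_)
      refine Fin.lastCases ?_ (fun l => ?_) l
      · simp only [Fin.snoc_last]
        fun_prop
      · simp only [Fin.snoc_castSucc]
        exact (Real.continuous_sin.comp continuous_snd).mul (hγ _ _)
    · simp only [frame, Fin.snoc_castSucc]
      refine (PiLp.continuous_toLp 2 _).comp (continuous_pi fun l => ?_)
      refine Fin.lastCases ?_ (fun l => ?_) l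
      · simp only [Fin.snoc_last]
        fun_prop
      · simp only [Fin.snoc_castSucc]
        exact hγ _ _
  have hP : ∀ z : Rot n × ℝ, (param hk z).1.starProjection =
      ∑ i, (innerSL ℝ (frame hk z.1 z.2 i)).smulRight (frame hk z.1 z.2 i) := by
    intro z
    have ho := frame_orthonormal hk z.1 z.2
    ext1 x
    refine Submodule.eq_starProjection_of_mem_of_inner_eq_zero
      (K := (param hk z).1) ?_ ?_
    · simp only [sum_apply, ContinuousLinearMap.smulRight_apply]
      exact Submodule.sum_mem _ fun i _ => Submodule.smul_mem _ _
        (Submodule.subset_span ⟨i, rfl⟩)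
    · intro w hw
      refine Submodule.span_induction ?_ ?_ ?_ ?_ hw
      · rintro _ ⟨i, rfl⟩
        simp only [sum_apply, ContinuousLinearMap.smulRight_apply,
          innerSL_apply_apply, inner_sub_left, sum_inner, inner_smul_left,
          orthonormal_iff_ite.1 ho]
        simp [real_inner_comm]
      · simp
      · intro a b _ _ ha hb
        rw [inner_add_right, ha, hb, add_zero]
      · intro c a _ ha
        rw [inner_smul_right, ha, mul_zero]
  simp only [Function.comp_def, hP]
  refine continuous_finsetSum _ fun i _ => ?_
  have h1 : Continuous fun z : Rot n × ℝ => innerSL ℝ (frame hk z.1 z.2 i) :=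
    (innerSL ℝ).continuous.comp (hf i)
  exact ((ContinuousLinearMap.smulRightL ℝ (Amb n) (Amb n)).continuous.comp h1).clm_apply (hf i)

lemma measurable_param {n k : ℕ} (hk : k < n) : Measurable (param (n := n) hk) :=
  (continuous_param hk).measurable

/-- The inequality
`‖sin^{γ₁} d(0,·) cos^{γ₂} d(0,·) R_k f‖_{L^∞(Ξ_k(𝕊^n))} ≤ C ‖f‖_{L^p_{α₁,α₂}(𝕊^n)}`
holds, with one constant `C`, for all radial `f` in `L^p_{α₁,α₂}(𝕊^n)`; in particular, `R_k f`
exists almost everywhere for these `f`. -/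
def RadialBound {n k : ℕ} (hk : k < n) (p α₁ α₂ γ₁ γ₂ : ℝ) : Prop :=
  ∃ C : ℝ≥0, ∀ f : Sph n → ℂ, IsRadial f → MemWLp p α₁ α₂ f →
    (∀ᵐ ξ ∂xiMeasure hk, PlaneTransformExistsAt (k := k) f ξ) ∧
    eLpNorm (fun ξ : Xi n k =>
      ((Real.sin (distXi ξ) ^ γ₁ * Real.cos (distXi ξ) ^ γ₂ : ℝ) : ℂ) * planeTransform k f ξ)
      ∞ (xiMeasure hk) ≤ C * wNorm p α₁ α₂ f

end KPlane

end

/-! Both sides of the inequality are one-dimensional for radial functions. On the unit sphere of an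
`(m+1)`-dimensional Euclidean space a coordinate has density proportional to `(1-s²)^((m-2)/2)`
(`exists_lintegral_toSphere_inner`). If `f` is a function `G` of the last coordinate and `c = cos
d(0,ξ)`, then the last coordinate on `ξ` is `c` times a coordinate of `ξ`. Up to constants, `R_k
f(ξ)` is therefore `∫ G(cs) (1-s²)^((k-2)/2) ds`, while the `p`-th power of the norm is `∫ |G(t)|^p
(1-t²)^((α₁+n-2)/2) |t|^α₂ dt`, both over `(-1,1)`. Only the weighted supremum over `c ∈ (0,1)`
remains to be studied (`radialBound_of_zonal`, `RadialBound.zonal`).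

Sufficiency for `p > 1` is Hölder's inequality after `t = cs`, and rests on a uniform bound for the
dual kernel (`exists_bound_kernel`). The powers of `c` require `γ₂ ≥ (1+α₂)/p`. Integrability at `s
= 0` is `α₂ < p-1`. Integrability of `(1-s²)^((k-2)q/2)` at `s = ±1`, with `q` conjugate to `p`, is
automatic for `k ≥ 2` and means `p > 2` for `k = 1`. Uniformity as `c → 1` gives the lower bound on
`γ₁`; at `p = (α₁+n)/k` a logarithm appears, which a positive `γ₁` absorbs. For `p = 1` the two
integrands are compared pointwise (`zonal_bound_one`).

Necessity uses indicators of short intervals, with `c → 0` for `γ₂` and `c → 1` for `γ₁`. For `k =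
1` the function `(1/2+ε-t)^(-1/2)` is tested near `c = 1/2`: its transform grows at least like `L =
log(1/ε)`, but its norm at most like `L^(1/2)` when `p ≤ 2` (`ZonalTest.two_lt`). -/

namespace KPlane

/-! ### Polar coordinates and the law of a coordinate on the unit sphere -/

/-- Integration in polar coordinates for non-negative functions. -/
lemma lintegral_eq_lintegral_toSphere {E : Type*} [NormedAddCommGroup E] [NormedSpace ℝ E]
    [MeasurableSpace E] [BorelSpace E] [FiniteDimensional ℝ E] [Nontrivial E]
    (μ : Measure E) [μ.IsAddHaarMeasure] {f : E → ℝ≥0∞} (hf : Measurable f) :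
    ∫⁻ x, f x ∂μ = ∫⁻ y : sphere (0 : E) 1, (∫⁻ r in Ioi (0 : ℝ),
      ENNReal.ofReal (r ^ (Module.finrank ℝ E - 1)) * f (r • (y : E))) ∂μ.toSphere := by
  have hm : Measurable fun p : sphere (0 : E) 1 × Ioi (0 : ℝ) => f ((p.2 : ℝ) • (p.1 : E)) := by
    refine hf.comp ?_
    exact (measurable_subtype_coe.comp measurable_snd).smul
      (measurable_subtype_coe.comp measurable_fst)
  calc ∫⁻ x, f x ∂μ = ∫⁻ x : ({(0)}ᶜ : Set E), f x.1 ∂(μ.comap (↑)) := by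
        rw [lintegral_subtype_comap (measurableSet_singleton _).compl, restrict_compl_singleton]
    _ = ∫⁻ p, f ((p.2 : ℝ) • (p.1 : E))
          ∂μ.toSphere.prod (.volumeIoiPow (Module.finrank ℝ E - 1)) := by
        rw [← μ.measurePreserving_homeomorphUnitSphereProd.lintegral_comp hm]
        refine lintegral_congr fun x => ?_
        congr 1
        have hx : ‖(x : E)‖ ≠ 0 := norm_ne_zero_iff.2 x.2
        simp [homeomorphUnitSphereProd, smul_smul, hx]
    _ = _ := by
        rw [lintegral_prod _ hm.aemeasurable]
        refine lintegral_congr fun y => ?_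
        rw [Measure.volumeIoiPow, lintegral_withDensity_eq_lintegral_mul]
        · simp only [Pi.mul_apply]
          rw [lintegral_subtype_comap measurableSet_Ioi
            fun r : ℝ => ENNReal.ofReal (r ^ (Module.finrank ℝ E - 1)) * f (r • (y : E))]
        · exact (measurable_subtype_coe.pow_const _).ennreal_ofReal
        · exact hm.comp measurable_prodMk_left

/-- Functions of `⟪e, x⟫` and `‖x‖`, integrated by splitting off the direction `e`. -/
lemma lintegral_inner_norm {E : Type*} [NormedAddCommGroup E] [InnerProductSpace ℝ E]
    [MeasurableSpace E] [BorelSpace E] [FiniteDimensional ℝ E] {m : ℕ}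
    (hE : Module.finrank ℝ E = m + 1) {e : E} (he : ‖e‖ = 1)
    {H : ℝ → ℝ → ℝ≥0∞} (hH : Measurable (Function.uncurry H)) :
    ∫⁻ x : E, H (inner ℝ e x) ‖x‖ =
      ∫⁻ t : ℝ, ∫⁻ z : EuclideanSpace ℝ (Fin m), H t (√(t ^ 2 + ‖z‖ ^ 2)) := by
  obtain ⟨b, hb⟩ := Orthonormal.exists_orthonormalBasis_extension_of_card_eq (𝕜 := ℝ)
    (ι := Fin (m + 1)) (v := fun _ => e) (s := {0}) (by simpa using hE) (by
      rw [orthonormal_iff_ite]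
      rintro ⟨i, rfl⟩ ⟨j, rfl⟩
      simp [Set.domRestrict, he])
  have hb0 : b 0 = e := hb 0 rfl
  have h1 : ∫⁻ x : E, H (inner ℝ e x) ‖x‖ =
      ∫⁻ x : EuclideanSpace ℝ (Fin (m + 1)), H (x 0) ‖x‖ := by
    rw [← b.measurePreserving_repr.lintegral_comp_emb b.repr.toHomeomorph.measurableEmbedding]
    refine lintegral_congr fun x => ?_
    rw [b.repr_apply_apply, hb0, b.repr.norm_map]
  have hmp := (volume_preserving_piFinSuccAbove (fun _ : Fin (m + 1) => ℝ) 0)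
  have hm2 : Measurable fun q : ℝ × (Fin m → ℝ) => H q.1 (√(q.1 ^ 2 + ∑ i, q.2 i ^ 2)) := by
    refine hH.comp (measurable_fst.prodMk ?_)
    fun_prop
  rw [h1]
  calc ∫⁻ x : EuclideanSpace ℝ (Fin (m + 1)), H (x 0) ‖x‖
      = ∫⁻ x : Fin (m + 1) → ℝ, H (x 0) (√(∑ i, x i ^ 2)) := by
        rw [← (PiLp.volume_preserving_ofLp (Fin (m + 1))).lintegral_comp_emb
          (MeasurableEquiv.toLp 2 _).symm.measurableEmbedding]
        refine lintegral_congr fun x => ?_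
        rw [EuclideanSpace.norm_eq]
        simp
    _ = ∫⁻ q : ℝ × (Fin m → ℝ), H q.1 (√(q.1 ^ 2 + ∑ i, q.2 i ^ 2)) := by
        rw [← hmp.lintegral_comp hm2]
        refine lintegral_congr fun x => ?_
        rw [Fin.sum_univ_succ]
        simp [MeasurableEquiv.piFinSuccAbove, Fin.tail]
    _ = ∫⁻ t : ℝ, ∫⁻ z : Fin m → ℝ, H t (√(t ^ 2 + ∑ i, z i ^ 2)) := by
        rw [Measure.volume_eq_prod, lintegral_prod _ hm2.aemeasurable]
    _ = _ := by
        refine lintegral_congr fun t => ?_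
        rw [← (PiLp.volume_preserving_ofLp (Fin m)).lintegral_comp_emb
          (MeasurableEquiv.toLp 2 _).symm.measurableEmbedding]
        refine lintegral_congr fun x => ?_
        rw [EuclideanSpace.norm_sq_eq]
        simp

/-- `∫ F(cos φ) sin^{m-1} φ dφ` over `(0, π)` after the substitution `s = cos φ`. -/
lemma setLIntegral_cos {m : ℕ} (hm : 1 ≤ m) (F : ℝ → ℝ≥0∞) :
    ∫⁻ φ in Ioo 0 Real.pi, ENNReal.ofReal (Real.sin φ ^ (m - 1)) * F (Real.cos φ) =
      ∫⁻ s in Ioo (-1 : ℝ) 1, F s * ENNReal.ofReal ((1 - s ^ 2) ^ (((m : ℝ) - 2) / 2)) := by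
  have himg : Real.cos '' Ioo 0 Real.pi = Ioo (-1) 1 := by
    ext s
    constructor
    · rintro ⟨φ, ⟨h0, h1⟩, rfl⟩
      constructor
      · rw [← Real.cos_pi]
        exact Real.cos_lt_cos_of_nonneg_of_le_pi h0.le le_rfl h1
      · rw [← Real.cos_zero]
        exact Real.cos_lt_cos_of_nonneg_of_le_pi le_rfl h1.le h0
    · rintro ⟨h0, h1⟩
      exact ⟨Real.arccos s, ⟨Real.arccos_pos.2 h1, Real.arccos_lt_pi.2 h0⟩,
        Real.cos_arccos h0.le h1.le⟩
  rw [← himg, lintegral_image_eq_lintegral_abs_deriv_mul (f' := fun x => -Real.sin x)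
    measurableSet_Ioo (fun x _ => (Real.hasDerivAt_cos x).hasDerivWithinAt)
    (Real.injOn_cos.mono Ioo_subset_Icc_self)]
  refine setLIntegral_congr_fun measurableSet_Ioo fun φ hφ => ?_
  have hs : 0 < Real.sin φ := Real.sin_pos_of_mem_Ioo hφ
  simp only [abs_neg, abs_of_pos hs]
  rw [mul_comm (F _), ← mul_assoc, ← ENNReal.ofReal_mul hs.le]
  congr 2
  rw [← Real.sin_sq, ← Real.rpow_natCast _ 2, ← Real.rpow_mul hs.le]
  nth_rw 2 [← Real.rpow_one (Real.sin φ)]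
  rw [← Real.rpow_add hs, ← Real.rpow_natCast]
  congr 1
  push_cast [hm]
  ring

/-- Plane polar coordinates `t = r cos φ`, `ρ = r sin φ`: the Jacobian `r` and the factor `ρ^(m-1)`
combine to `r^m sin^(m-1) φ`, and `F` sees only the angle. The condition `ρ > 0` enters as an
indicator, which cuts the polar range `(-π, π)` down to `(0, π)`. -/
lemma lintegral_halfPlane {m : ℕ} (hm : 1 ≤ m) {F : ℝ → ℝ≥0∞} (hF : Measurable F) :
    ∫⁻ t : ℝ, ∫⁻ ρ in Ioi (0 : ℝ), ENNReal.ofReal (ρ ^ (m - 1)) *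
        (F (t / √(t ^ 2 + ρ ^ 2)) * (Iio (1 : ℝ)).indicator 1 (√(t ^ 2 + ρ ^ 2))) =
      (∫⁻ r in Ioo (0 : ℝ) 1, ENNReal.ofReal (r ^ m)) *
        ∫⁻ φ in Ioo 0 Real.pi, ENNReal.ofReal (Real.sin φ ^ (m - 1)) * F (Real.cos φ) := by
  set K : ℝ × ℝ → ℝ≥0∞ := fun q => (Ioi (0 : ℝ)).indicator 1 q.2 * (ENNReal.ofReal (q.2 ^ (m - 1)) *
        (F (q.1 / √(q.1 ^ 2 + q.2 ^ 2)) * (Iio (1 : ℝ)).indicator 1 (√(q.1 ^ 2 + q.2 ^ 2)))) with hK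
  have hKm : Measurable K := by
    have h1 : Measurable ((Iio (1 : ℝ)).indicator (1 : ℝ → ℝ≥0∞)) :=
      measurable_one.indicator measurableSet_Iio
    have h2 : Measurable ((Ioi (0 : ℝ)).indicator (1 : ℝ → ℝ≥0∞)) :=
      measurable_one.indicator measurableSet_Ioi
    have h3 : Measurable fun q : ℝ × ℝ => √(q.1 ^ 2 + q.2 ^ 2) := by fun_prop
    refine (h2.comp measurable_snd).mul ((measurable_snd.pow_const _).ennreal_ofReal.mul
      ((hF.comp (measurable_fst.div h3)).mul (h1.comp h3)))
  have e1 : ∫⁻ t : ℝ, ∫⁻ ρ in Ioi (0 : ℝ), ENNReal.ofReal (ρ ^ (m - 1)) *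
        (F (t / √(t ^ 2 + ρ ^ 2)) * (Iio (1 : ℝ)).indicator 1 (√(t ^ 2 + ρ ^ 2))) =
      ∫⁻ q : ℝ × ℝ, K q := by
    rw [Measure.volume_eq_prod, lintegral_prod _ hKm.aemeasurable]
    refine lintegral_congr fun t => ?_
    rw [← lintegral_indicator measurableSet_Ioi]
    refine lintegral_congr fun ρ => ?_
    by_cases h : ρ ∈ Ioi (0 : ℝ) <;> simp [hK, h]
  rw [e1, ← lintegral_comp_polarCoord_symm, polarCoord_target]
  rw [Measure.volume_eq_prod, ← Measure.prod_restrict, lintegral_prod]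
  swap
  · refine Measurable.aemeasurable ?_
    exact measurable_fst.ennreal_ofReal.smul
      (hKm.comp continuous_polarCoord_symm.measurable)
  rw [← lintegral_mul_const _ (by fun_prop), ← lintegral_indicator measurableSet_Ioo,
    ← lintegral_indicator measurableSet_Ioi]
  refine lintegral_congr fun r => ?_
  by_cases hr : 0 < r
  swap
  · rw [indicator_of_notMem (by simpa using hr), indicator_of_notMem (by simp [hr])]
  rw [indicator_of_mem (by simpa using hr)]
  have hnorm : ∀ φ : ℝ, √((r * Real.cos φ) ^ 2 + (r * Real.sin φ) ^ 2) = r := fun φ => by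
    rw [mul_pow, mul_pow, ← mul_add, Real.cos_sq_add_sin_sq, mul_one, Real.sqrt_sq hr.le]
  simp only [polarCoord_symm_apply, hK, hnorm, smul_eq_mul]
  by_cases hr1 : r < 1
  swap
  · rw [indicator_of_notMem (by simp [hr1])]
    simp [hr1]
  rw [indicator_of_mem (a := r) (s := Ioo 0 1) ⟨hr, hr1⟩, ← lintegral_const_mul' _ _ ENNReal.ofReal_ne_top,
    ← lintegral_indicator measurableSet_Ioo, ← lintegral_indicator measurableSet_Ioo]
  refine lintegral_congr fun φ => ?_
  by_cases h1 : φ ∈ Ioo 0 Real.pi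
  · have hs : 0 < Real.sin φ := Real.sin_pos_of_mem_Ioo h1
    have h2 : φ ∈ Ioo (-Real.pi) Real.pi := ⟨by linarith [h1.1, Real.pi_pos], h1.2⟩
    rw [indicator_of_mem h1, indicator_of_mem h2, indicator_of_mem (by simpa using mul_pos hr hs),
      indicator_of_mem (by simpa using hr1), mul_div_cancel_left₀ _ hr.ne']
    simp only [Pi.one_apply, mul_one, one_mul]
    rw [← mul_assoc, ← mul_assoc, ← ENNReal.ofReal_mul hr.le, ← ENNReal.ofReal_mul (by positivity),
      mul_pow, ← mul_assoc, ← pow_succ', Nat.sub_add_cancel hm]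
  · rw [indicator_of_notMem h1]
    by_cases h2 : φ ∈ Ioo (-Real.pi) Real.pi
    · have h3 : φ ≤ 0 := not_lt.1 fun h => h1 ⟨h, h2.2⟩
      have hs : Real.sin φ ≤ 0 := Real.sin_nonpos_of_nonpos_of_neg_pi_le h3 h2.1.le
      rw [indicator_of_mem h2, indicator_of_notMem]
      · simp
      · simpa using mul_nonpos_of_nonneg_of_nonpos hr.le hs
    · rw [indicator_of_notMem h2]

/-- The distribution of a coordinate on the unit sphere of a Euclidean space of dimension `m + 1`,
up to a constant depending only on `m`. -/
theorem exists_lintegral_toSphere_inner {m : ℕ} (hm : 1 ≤ m) :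
    ∃ C : ℝ≥0∞, C ≠ 0 ∧ C ≠ ∞ ∧ ∀ (E : Type) [NormedAddCommGroup E] [InnerProductSpace ℝ E]
      [MeasurableSpace E] [BorelSpace E] [FiniteDimensional ℝ E], Module.finrank ℝ E = m + 1 →
      ∀ e : E, ‖e‖ = 1 → ∀ F : ℝ → ℝ≥0∞, Measurable F →
        ∫⁻ y : sphere (0 : E) 1, F (inner ℝ e (y : E)) ∂(volume : Measure E).toSphere =
          C * ∫⁻ s in Ioo (-1 : ℝ) 1,
            F s * ENNReal.ofReal ((1 - s ^ 2) ^ (((m : ℝ) - 2) / 2)) := by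
  have : Nonempty (Fin m) := ⟨⟨0, hm⟩⟩
  refine ⟨(volume : Measure (EuclideanSpace ℝ (Fin m))).toSphere univ, ?_, measure_ne_top _ _,
    fun E _ _ _ _ _ hE e he F hF => ?_⟩
  · exact (Measure.measure_univ_pos.2 (Measure.toSphere_ne_zero _)).ne'
  have : Nontrivial E := Module.nontrivial_of_finrank_pos (R := ℝ) (by omega)
  set I : ℝ≥0∞ := ∫⁻ r in Ioo (0 : ℝ) 1, ENNReal.ofReal (r ^ m) with hI
  have hI0 : I ≠ 0 := by
    refine ne_of_gt ?_
    rw [hI, setLIntegral_pos_iff (by fun_prop)]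
    have : Function.support (fun r : ℝ => ENNReal.ofReal (r ^ m)) ∩ Ioo 0 1 = Ioo 0 1 := by
      refine inter_eq_right.2 fun r hr => ?_
      simpa using pow_pos hr.1 m
    rw [this]
    simp
  have hI1 : I ≠ ∞ := by
    refine ne_of_lt ((setLIntegral_mono (g := fun _ => 1) (by fun_prop) fun r hr => ?_).trans_lt ?_)
    · exact ENNReal.ofReal_le_one.2 (pow_le_one₀ hr.1.le hr.2.le)
    · simp
  -- A degree-zero extension of `F`, cut off to the unit ball. Its integral is computed in two ways,
  -- by polar coordinates in `E` and by splitting off the direction `e`; each produces the radial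
  -- factor `I`, which is positive and finite and so cancels.
  set H : ℝ → ℝ → ℝ≥0∞ := fun t r => F (t / r) * (Iio (1 : ℝ)).indicator 1 r with hH
  have h1 : Measurable ((Iio (1 : ℝ)).indicator (1 : ℝ → ℝ≥0∞)) :=
    measurable_one.indicator measurableSet_Iio
  have hHm : Measurable (Function.uncurry H) :=
    (hF.comp (measurable_fst.div measurable_snd)).mul (h1.comp measurable_snd)
  have hHm' : Measurable fun x : E => H (inner ℝ e x) ‖x‖ :=
    hHm.comp (f := fun x : E => (inner ℝ e x, ‖x‖)) (by fun_prop)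
  have e1 : ∫⁻ x : E, H (inner ℝ e x) ‖x‖ =
      I * ∫⁻ y : sphere (0 : E) 1, F (inner ℝ e (y : E)) ∂(volume : Measure E).toSphere := by
    rw [lintegral_eq_lintegral_toSphere _ hHm', ← lintegral_const_mul' _ _ hI1]
    refine lintegral_congr fun y => ?_
    rw [hI, ← lintegral_mul_const _ (by fun_prop), ← lintegral_indicator measurableSet_Ioo,
      ← lintegral_indicator measurableSet_Ioi]
    refine lintegral_congr fun r => ?_
    by_cases hr : 0 < r
    swap
    · rw [indicator_of_notMem (by simpa using hr), indicator_of_notMem (by simp [hr])]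
    rw [indicator_of_mem (by simpa using hr)]
    have hn : ‖r • (y : E)‖ = r := by simp [norm_smul, abs_of_pos hr]
    simp only [hH, hn, inner_smul_right, mul_div_cancel_left₀ _ hr.ne', hE, Nat.add_sub_cancel]
    by_cases hr1 : r < 1 <;> simp [hr1, hr]
  have e2 : ∫⁻ x : E, H (inner ℝ e x) ‖x‖ =
      I * ((volume : Measure (EuclideanSpace ℝ (Fin m))).toSphere univ *
        ∫⁻ φ in Ioo 0 Real.pi, ENNReal.ofReal (Real.sin φ ^ (m - 1)) * F (Real.cos φ)) := by
    rw [lintegral_inner_norm hE he hHm, mul_left_comm, hI, ← lintegral_halfPlane hm hF,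
      ← lintegral_const_mul' _ _ (measure_ne_top _ _)]
    refine lintegral_congr fun t => ?_
    have hmz : Measurable fun z : EuclideanSpace ℝ (Fin m) => H t (√(t ^ 2 + ‖z‖ ^ 2)) :=
      hHm.comp (f := fun z : EuclideanSpace ℝ (Fin m) => (t, √(t ^ 2 + ‖z‖ ^ 2))) (by fun_prop)
    rw [lintegral_eq_lintegral_toSphere _ hmz]
    have : ∀ y : sphere (0 : EuclideanSpace ℝ (Fin m)) 1,
        ∫⁻ r in Ioi (0 : ℝ), ENNReal.ofReal (r ^ (Module.finrank ℝ (EuclideanSpace ℝ (Fin m)) - 1)) *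
          H t (√(t ^ 2 + ‖r • (y : EuclideanSpace ℝ (Fin m))‖ ^ 2)) =
        ∫⁻ ρ in Ioi (0 : ℝ), ENNReal.ofReal (ρ ^ (m - 1)) *
          (F (t / √(t ^ 2 + ρ ^ 2)) * (Iio (1 : ℝ)).indicator 1 (√(t ^ 2 + ρ ^ 2))) := by
      intro y
      refine setLIntegral_congr_fun measurableSet_Ioi fun r hr => ?_
      have hn : ‖r • (y : EuclideanSpace ℝ (Fin m))‖ = r := by
        simp [norm_smul, abs_of_pos (mem_Ioi.1 hr)]
      simp [hn, hH]
    rw [lintegral_congr this, lintegral_const, mul_comm]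
  rw [e1, setLIntegral_cos hm] at e2
  exact (ENNReal.mul_right_inj hI0 hI1).1 e2

/-! ### Zonal functions as functions of the last coordinate -/

lemma inner_pole {n : ℕ} (x : Amb n) : inner ℝ (pole n) x = x (Fin.last n) := by
  simp [pole, EuclideanSpace.inner_single_left]

lemma norm_pole (n : ℕ) : ‖pole n‖ = 1 := by simp [pole]

lemma cos_dist0 {n : ℕ} (x : Sph n) : Real.cos (dist0 (x : Amb n)) = (x : Amb n) (Fin.last n) := by
  rw [dist0, InnerProductGeometry.cos_angle, inner_pole, norm_pole, norm_eq_of_mem_sphere x]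
  simp

lemma sin_dist0 {n : ℕ} (x : Sph n) :
    Real.sin (dist0 (x : Amb n)) = √(1 - (x : Amb n) (Fin.last n) ^ 2) := by
  rw [← cos_dist0, ← Real.sin_sq, Real.sqrt_sq]
  exact Real.sin_nonneg_of_mem_Icc
    ⟨InnerProductGeometry.angle_nonneg _ _, InnerProductGeometry.angle_le_pi _ _⟩

/-- A zonal measurable function is a measurable function of the last coordinate. -/
lemma IsRadial.exists_measurable {n : ℕ} (hn : 1 ≤ n) {f : Sph n → ℂ} (hf : IsRadial f)
    (hm : Measurable f) :
    ∃ G : ℝ → ℂ, Measurable G ∧ ∀ x : Sph n, f x = G ((x : Amb n) (Fin.last n)) := by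
  obtain ⟨g, hg⟩ := hf
  obtain ⟨m, rfl⟩ : ∃ m, n = m + 1 := ⟨n - 1, by omega⟩
  -- The given `g` need not be measurable, so `f` is composed with a measurable section of the
  -- height function. Since `arccos` is clamped, `v t` lies on the sphere for every real `t`, also
  -- outside `[-1, 1]`.
  set v : ℝ → Amb (m + 1) := fun t => Real.sin (Real.arccos t) • EuclideanSpace.single 0 1 +
    Real.cos (Real.arccos t) • EuclideanSpace.single (Fin.last (m + 1)) 1 with hv
  have hv1 : ∀ t, ‖v t‖ = 1 := fun t => by
    have h : inner ℝ (Real.sin (Real.arccos t) • EuclideanSpace.single 0 1 : Amb (m + 1))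
        (Real.cos (Real.arccos t) • EuclideanSpace.single (Fin.last (m + 1)) 1) = 0 := by
      simp [inner_smul_left, inner_smul_right, EuclideanSpace.inner_single_left]
    have h2 := norm_add_sq_eq_norm_sq_add_norm_sq_of_inner_eq_zero _ _ h
    rw [norm_smul, norm_smul] at h2
    simp only [PiLp.norm_single, norm_one, mul_one, Real.norm_eq_abs,
      ← sq, sq_abs, Real.sin_sq_add_cos_sq] at h2
    exact (pow_eq_one_iff_of_nonneg (norm_nonneg _) two_ne_zero).1 h2
  have hvm : Measurable v := by
    have : Continuous v := by fun_prop
    exact this.measurable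
  have hvs : ∀ t, v t ∈ sphere (0 : Amb (m + 1)) 1 := fun t => by simp [hv1]
  refine ⟨fun t => f ⟨v t, hvs t⟩, hm.comp (hvm.subtype_mk (h := hvs)), fun x => ?_⟩
  have habs : |(x : Amb (m + 1)) (Fin.last _)| ≤ 1 := by
    have := PiLp.norm_apply_le (x : Amb (m + 1)) (Fin.last _)
    rwa [norm_eq_of_mem_sphere x] at this
  beta_reduce
  rw [hg, hg, cos_dist0, cos_dist0]
  congr 1
  simp [hv, Real.cos_arccos (abs_le.1 habs).1 (abs_le.1 habs).2]

/-! ### Distance from the pole to a submanifold, and its distribution -/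

/-- The cosine of the distance from the pole to `ξ = W ∩ 𝕊^n`: the length of the orthogonal
projection of the pole to `W`. -/
noncomputable def Xi.height {n k : ℕ} (ξ : Xi n k) : ℝ := ‖ξ.1.starProjection (pole n)‖

lemma Xi.continuous_height {n k : ℕ} : Continuous (Xi.height (n := n) (k := k)) := by
  have h : Continuous fun ξ : Xi n k => ξ.1.starProjection := continuous_induced_dom
  exact (h.clm_apply continuous_const).norm

lemma height_param {n k : ℕ} (hk : k < n) (γ : Rot n) (θ : ℝ) :
    (param hk (γ, θ)).height = |Real.cos θ| := by
  have ho := frame_orthonormal hk γ θ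
  -- The pole is orthogonal to every frame vector except the last, with which its inner product is
  -- `cos θ`.
  have hp : (param hk (γ, θ)).1.starProjection (pole n) =
      Real.cos θ • frame hk γ θ (Fin.last k) := by
    refine Submodule.eq_starProjection_of_mem_of_inner_eq_zero ?_ ?_
    · exact Submodule.smul_mem _ _ (Submodule.subset_span ⟨_, rfl⟩)
    · intro w hw
      refine Submodule.span_induction ?_ ?_ ?_ ?_ hw
      · rintro _ ⟨i, rfl⟩
        rw [inner_sub_left, inner_smul_left, inner_pole, orthonormal_iff_ite.1 ho]
        refine Fin.lastCases ?_ (fun j => ?_) i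
        · simp [frame]
        · simp [frame, (Fin.castSucc_lt_last j).ne']
      · simp
      · intro a b _ _ ha hb
        rw [inner_add_right, ha, hb, add_zero]
      · intro c a _ ha
        rw [inner_smul_right, ha, mul_zero]
  rw [Xi.height, hp, norm_smul, ho.norm_eq_one, mul_one, Real.norm_eq_abs]

/-- The foot of the perpendicular from the pole to `ξ`. -/
lemma Xi.exists_foot {n k : ℕ} (ξ : Xi n k) (h : 0 < ξ.height) :
    ∃ e : ξ.1, ‖e‖ = 1 ∧ ∀ y : ξ.1, (y : Amb n) (Fin.last n) = ξ.height * inner ℝ e y := by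
  refine ⟨ξ.height⁻¹ • ⟨ξ.1.starProjection (pole n), Submodule.starProjection_apply_mem _ _⟩,
    ?_, fun y => ?_⟩
  · rw [norm_smul, norm_inv, Real.norm_of_nonneg h.le]
    exact inv_mul_cancel₀ h.ne'
  · change _ = ξ.height * inner ℝ (ξ.height⁻¹ • ξ.1.starProjection (pole n)) (y : Amb n)
    rw [inner_smul_left, ← mul_assoc, conj_trivial, mul_inv_cancel₀ h.ne', one_mul]
    rw [Submodule.inner_starProjection_left_eq_right,
      Submodule.starProjection_eq_self_iff.2 y.2, inner_pole]

lemma Xi.distXi_eq {n k : ℕ} (ξ : Xi n k) (h : 0 < ξ.height) : distXi ξ = Real.arccos ξ.height := by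
  obtain ⟨e, he, hy⟩ := ξ.exists_foot h
  have hd : ∀ y : sphere (0 : ξ.1) 1,
      dist0 ((y : ξ.1) : Amb n) = Real.arccos (ξ.height * inner ℝ e (y : ξ.1)) := by
    intro y
    have : ‖((y : ξ.1) : Amb n)‖ = 1 := norm_eq_of_mem_sphere y
    rw [dist0, InnerProductGeometry.angle, inner_pole, hy, norm_pole, this]
    simp
  have hb : BddBelow (range fun y : sphere (0 : ξ.1) 1 => dist0 ((y : ξ.1) : Amb n)) :=
    ⟨0, by rintro _ ⟨y, rfl⟩; exact InnerProductGeometry.angle_nonneg _ _⟩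
  have : Nonempty (sphere (0 : ξ.1) 1) := ⟨⟨e, by simpa using he⟩⟩
  refine le_antisymm ?_ (le_ciInf fun y => ?_)
  · refine (ciInf_le hb ⟨e, by simpa using he⟩).trans ?_
    rw [hd]
    simp [he]
  · rw [hd]
    refine Real.arccos_le_arccos ?_
    have h1 := real_inner_le_norm e (y : ξ.1)
    rw [he, norm_eq_of_mem_sphere y] at h1
    nlinarith

lemma Xi.cos_distXi {n k : ℕ} (ξ : Xi n k) (h : ξ.height ∈ Ioo (0 : ℝ) 1) :
    Real.cos (distXi ξ) = ξ.height := by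
  rw [ξ.distXi_eq h.1, Real.cos_arccos (by linarith [h.1]) h.2.le]

lemma Xi.sin_distXi {n k : ℕ} (ξ : Xi n k) (h : ξ.height ∈ Ioo (0 : ℝ) 1) :
    Real.sin (distXi ξ) = √(1 - ξ.height ^ 2) := by
  rw [ξ.distXi_eq h.1, Real.sin_arccos]

lemma xiMeasure_ae_height {n k : ℕ} (hk : k < n) :
    ∀ᵐ ξ ∂xiMeasure hk, ξ.height ∈ Ioo (0 : ℝ) 1 := by
  rw [xiMeasure, ae_map_iff (measurable_param hk).aemeasurable
    (Xi.continuous_height.measurable measurableSet_Ioo)]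
  have h : ∀ᵐ θ ∂((volume.restrict (Set.Ioo (0 : ℝ) (Real.pi / 2))).withDensity fun θ =>
      ENNReal.ofReal (Real.sin θ ^ (n - k - 1) * Real.cos θ ^ k)), θ ∈ Ioo 0 (Real.pi / 2) :=
    (withDensity_absolutelyContinuous _ _).ae_le (ae_restrict_mem measurableSet_Ioo)
  filter_upwards [Measure.quasiMeasurePreserving_snd.ae h] with z hz
  have hc : 0 < Real.cos z.2 := Real.cos_pos_of_mem_Ioo ⟨by linarith [hz.1, Real.pi_pos], hz.2⟩
  rw [height_param, abs_of_pos hc]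
  refine ⟨hc, ?_⟩
  rw [← Real.cos_zero]
  exact Real.cos_lt_cos_of_nonneg_of_le_pi_div_two le_rfl hz.2.le hz.1

/-- The density `sin^(n-k-1) θ cos^k θ` is positive on `(0, π/2)`, so every band of distances has
positive measure and meets any conull set. This turns an essential supremum into information at
submanifolds with `cos d(0,ξ)` in a prescribed interval. -/
lemma xiMeasure_exists_height {n k : ℕ} (hk : k < n) {P : Xi n k → Prop}
    (hP : ∀ᵐ ξ ∂xiMeasure hk, P ξ) {a b : ℝ} (ha : 0 ≤ a) (hab : a < b) (hb : b ≤ 1) :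
    ∃ ξ : Xi n k, ξ.height ∈ Ioo a b ∧ P ξ := by
  have h1 := ae_of_ae_map (measurable_param hk).aemeasurable hP
  set ν : Measure ℝ := (volume.restrict (Set.Ioo (0 : ℝ) (Real.pi / 2))).withDensity fun θ =>
      ENNReal.ofReal (Real.sin θ ^ (n - k - 1) * Real.cos θ ^ k) with hν
  set S : Set ℝ := Ioo (Real.arccos b) (Real.arccos a) with hS
  have hSub : S ⊆ Ioo 0 (Real.pi / 2) := fun θ hθ =>
    ⟨(Real.arccos_nonneg b).trans_lt hθ.1, hθ.2.trans_le (Real.arccos_le_pi_div_two.2 ha)⟩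
  have hνS : ν S ≠ 0 := by
    rw [hν, withDensity_apply _ measurableSet_Ioo, Measure.restrict_restrict measurableSet_Ioo,
      inter_eq_left.2 hSub]
    refine ne_of_gt ?_
    rw [setLIntegral_pos_iff (by fun_prop)]
    rw [inter_eq_right.2]
    · simpa [hS] using Real.arccos_lt_arccos (by linarith) hab hb
    · intro θ hθ
      have h := hSub hθ
      have hs : 0 < Real.sin θ := Real.sin_pos_of_mem_Ioo ⟨h.1, by linarith [h.2, Real.pi_pos]⟩
      have hc : 0 < Real.cos θ := Real.cos_pos_of_mem_Ioo ⟨by linarith [h.1, Real.pi_pos], h.2⟩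
      have : 0 < Real.sin θ ^ (n - k - 1) * Real.cos θ ^ k := by positivity
      simpa using this
  have hpos : ((Rot.haar n).prod ν) (univ ×ˢ S) ≠ 0 := by
    rw [Measure.prod_prod]
    refine mul_ne_zero ?_ hνS
    have : (Rot.haar n) univ = 1 := by
      simpa [Rot.haar] using Measure.haarMeasure_self
        (K₀ := (⟨⟨univ, isCompact_univ⟩, by simp⟩ : TopologicalSpace.PositiveCompacts (Rot n)))
    simp [this]
  obtain ⟨z, hz, hz2⟩ : ∃ z ∈ univ ×ˢ S, P (param hk z) := by
    by_contra! hcon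
    exact hpos (measure_mono_null (fun z hz => hcon z hz) h1)
  refine ⟨param hk z, ?_, hz2⟩
  have h := hSub hz.2
  have hc : 0 < Real.cos z.2 := Real.cos_pos_of_mem_Ioo ⟨by linarith [h.1, Real.pi_pos], h.2⟩
  have hpi := Real.pi_pos
  rw [show z = (z.1, z.2) from rfl, height_param, abs_of_pos hc]
  constructor
  · rw [← Real.cos_arccos (x := a) (by linarith) (by linarith)]
    exact Real.cos_lt_cos_of_nonneg_of_le_pi h.1.le (Real.arccos_le_pi _) hz.2.2
  · rw [← Real.cos_arccos (x := b) (by linarith) hb]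
    exact Real.cos_lt_cos_of_nonneg_of_le_pi (Real.arccos_nonneg _) (by linarith [h.2]) hz.2.1

/-! ### Reduction to an inequality on the interval `(-1, 1)` -/

/-- The totally geodesic transform of a zonal function, up to a constant: `c` is the cosine of the
distance from the pole to the submanifold. -/
noncomputable def zonalTransform (k : ℕ) (c : ℝ) (g : ℝ → ℝ≥0∞) : ℝ≥0∞ :=
  ∫⁻ s in Ioo (-1 : ℝ) 1, g (c * s) * ENNReal.ofReal ((1 - s ^ 2) ^ (((k : ℝ) - 2) / 2))

/-- The `p`-th power of the norm of a zonal function, up to a constant. -/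
noncomputable def zonalNormPow (n : ℕ) (p α₁ α₂ : ℝ) (g : ℝ → ℝ≥0∞) : ℝ≥0∞ :=
  ∫⁻ t in Ioo (-1 : ℝ) 1,
    g t ^ p * ENNReal.ofReal ((1 - t ^ 2) ^ ((α₁ + n - 2) / 2) * |t| ^ α₂)

/-- The weight `sin^α₁` contributes `(1-t²)^(α₁/2)`, which merges with the coordinate density
`(1-t²)^((n-2)/2)`. -/
lemma exists_wNorm_zonal {n : ℕ} (hn : 1 ≤ n) (p α₁ α₂ : ℝ) (hp : 0 < p) :
    ∃ C : ℝ≥0, C ≠ 0 ∧ ∀ G : ℝ → ℂ, Measurable G →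
      wNorm p α₁ α₂ (fun x : Sph n => G ((x : Amb n) (Fin.last n))) =
        C * zonalNormPow n p α₁ α₂ (fun t => ‖G t‖ₑ) ^ (1 / p) := by
  obtain ⟨C, hC0, hC1, hC⟩ := exists_lintegral_toSphere_inner hn
  refine ⟨(C ^ (1 / p)).toNNReal, ?_, fun G hG => ?_⟩
  · rw [Ne, ENNReal.toNNReal_eq_zero_iff, not_or]
    refine ⟨?_, ENNReal.rpow_ne_top_of_nonneg (by positivity) hC1⟩
    simp [ENNReal.rpow_eq_zero_iff, hC0, hC1]
  rw [ENNReal.coe_toNNReal (ENNReal.rpow_ne_top_of_nonneg (by positivity) hC1),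
    ← ENNReal.mul_rpow_of_nonneg _ _ (by positivity), wNorm]
  congr 1
  have hF : Measurable fun t : ℝ => ‖G t‖ₑ ^ p * ENNReal.ofReal (√(1 - t ^ 2) ^ α₁ * |t| ^ α₂) := by
    fun_prop
  have := hC (Amb n) (by simp) (pole n) (norm_pole n) _ hF
  simp only [inner_pole] at this
  simp only [cos_dist0, sin_dist0]
  rw [sphMeasure, this, zonalNormPow]
  congr 1
  refine setLIntegral_congr_fun measurableSet_Ioo fun t ht => ?_
  have ht2 : 0 < 1 - t ^ 2 := by nlinarith [ht.1, ht.2]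
  rw [mul_assoc, ← ENNReal.ofReal_mul (by positivity), mul_right_comm, Real.sqrt_eq_rpow,
    ← Real.rpow_mul ht2.le, ← Real.rpow_add ht2]
  ring_nf

/-- The last coordinate on `ξ` is `ξ.height` times the coordinate along the foot of the
perpendicular, so the coordinate law in `W` applies. The constant depends on `k` alone, which makes
the reduction uniform in `ξ`. -/
lemma exists_lintegral_induced {k : ℕ} (hk : 1 ≤ k) :
    ∃ C : ℝ≥0, C ≠ 0 ∧ ∀ (n : ℕ) (ξ : Xi n k), 0 < ξ.height → ∀ g : ℝ → ℝ≥0∞, Measurable g →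
      ∫⁻ y, g ((ξ.incl y : Amb n) (Fin.last n)) ∂ξ.inducedMeasure =
        C * zonalTransform k ξ.height g := by
  obtain ⟨C, hC0, hC1, hC⟩ := exists_lintegral_toSphere_inner hk
  lift C to ℝ≥0 using hC1
  refine ⟨C, by simpa using hC0, fun n ξ hξ g hg => ?_⟩
  obtain ⟨e, he, hy⟩ := ξ.exists_foot hξ
  have := hC ξ.1 ξ.2 e he (fun s => g (ξ.height * s)) (by fun_prop)
  rw [zonalTransform, ← this, Xi.inducedMeasure]
  refine lintegral_congr fun y => ?_
  rw [← hy]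
  rfl

lemma Xi.continuous_incl {n k : ℕ} (ξ : Xi n k) : Continuous ξ.incl :=
  (continuous_subtype_val.comp continuous_subtype_val).subtype_mk _

/-- The bound follows from an inequality between integrals over `(-1, 1)`. -/
theorem radialBound_of_zonal {n k : ℕ} (hk1 : 1 ≤ k) (hk : k < n) {p α₁ α₂ γ₁ γ₂ : ℝ} (hp : 0 < p)
    (h : ∃ K : ℝ≥0, ∀ g : ℝ → ℝ≥0∞, Measurable g → ∀ c ∈ Ioo (0 : ℝ) 1,
      ENNReal.ofReal (√(1 - c ^ 2) ^ γ₁ * c ^ γ₂) * zonalTransform k c g ≤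
        K * zonalNormPow n p α₁ α₂ g ^ (1 / p)) :
    RadialBound hk p α₁ α₂ γ₁ γ₂ := by
  obtain ⟨K, hK⟩ := h
  obtain ⟨C₁, hC₁, h1⟩ := exists_wNorm_zonal (n := n) (by omega) p α₁ α₂ hp
  obtain ⟨C₂, hC₂, h2⟩ := exists_lintegral_induced hk1
  refine ⟨C₂ * K * C₁⁻¹, fun f hf hfm => ?_⟩
  obtain ⟨G, hG, hfG⟩ := hf.exists_measurable (by omega) hfm.1
  have hw : wNorm p α₁ α₂ f = C₁ * zonalNormPow n p α₁ α₂ (fun t => ‖G t‖ₑ) ^ (1 / p) := by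
    rw [← h1 G hG]
    congr 1
    exact funext hfG
  have hN : (zonalNormPow n p α₁ α₂ fun t => ‖G t‖ₑ) ^ (1 / p) = (C₁ : ℝ≥0∞)⁻¹ * wNorm p α₁ α₂ f := by
    rw [hw, ← mul_assoc, ENNReal.inv_mul_cancel (by simpa using hC₁) ENNReal.coe_ne_top, one_mul]
  have hpt : ∀ ξ : Xi n k, ξ.height ∈ Ioo (0 : ℝ) 1 →
      ENNReal.ofReal (Real.sin (distXi ξ) ^ γ₁ * Real.cos (distXi ξ) ^ γ₂) *
        ∫⁻ y, ‖f (ξ.incl y)‖ₑ ∂ξ.inducedMeasure ≤ (C₂ * K * C₁⁻¹ : ℝ≥0) * wNorm p α₁ α₂ f := by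
    intro ξ hξ
    have h3 := h2 n ξ hξ.1 (fun t => ‖G t‖ₑ) (by fun_prop)
    simp only [← hfG] at h3
    rw [h3, ξ.cos_distXi hξ, ξ.sin_distXi hξ, mul_left_comm]
    refine (mul_le_mul_right (hK _ (by fun_prop) _ hξ) _).trans_eq ?_
    rw [hN, ENNReal.coe_mul, ENNReal.coe_mul, ENNReal.coe_inv hC₁]
    ring
  have hpos : ∀ ξ : Xi n k, ξ.height ∈ Ioo (0 : ℝ) 1 →
      0 < Real.sin (distXi ξ) ^ γ₁ * Real.cos (distXi ξ) ^ γ₂ := by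
    intro ξ hξ
    have h4 : 0 < 1 - ξ.height ^ 2 := by nlinarith [hξ.1, hξ.2]
    have h5 := hξ.1
    rw [ξ.cos_distXi hξ, ξ.sin_distXi hξ]
    positivity
  constructor
  · filter_upwards [xiMeasure_ae_height hk] with ξ hξ
    refine ⟨(hfm.1.comp ξ.continuous_incl.measurable).aestronglyMeasurable, ?_⟩
    refine lt_top_iff_ne_top.2 fun htop => ?_
    have h3 := hpt ξ hξ
    -- The weight is strictly positive at every height in `(0, 1)`, so the finite right-hand side
    -- excludes an infinite integral: existence of the transform comes with the estimate.
    rw [htop, ENNReal.mul_top (by simpa using hpos ξ hξ), top_le_iff] at h3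
    exact ENNReal.mul_ne_top ENNReal.coe_ne_top hfm.2.ne h3
  · rw [eLpNorm_exponent_top]
    refine eLpNormEssSup_le_of_ae_enorm_bound ?_
    filter_upwards [xiMeasure_ae_height hk] with ξ hξ
    refine le_trans ?_ (hpt ξ hξ)
    rw [enorm_mul]
    gcongr
    · rw [← ofReal_norm, Complex.norm_real, Real.norm_of_nonneg (hpos ξ hξ).le]
    · exact enorm_integral_le_lintegral_enorm _

/-- The bound, tested on non-negative zonal functions. -/
theorem RadialBound.zonal {n k : ℕ} (hk1 : 1 ≤ k) (hk : k < n) {p α₁ α₂ γ₁ γ₂ : ℝ} (hp : 0 < p)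
    (h : RadialBound hk p α₁ α₂ γ₁ γ₂) :
    ∃ K : ℝ≥0, ∀ g : ℝ → ℝ≥0, Measurable g → zonalNormPow n p α₁ α₂ (fun t => g t) ≠ ∞ →
      ∀ a b : ℝ, 0 ≤ a → a < b → b ≤ 1 → ∃ c ∈ Ioo a b,
        ENNReal.ofReal (√(1 - c ^ 2) ^ γ₁ * c ^ γ₂) * zonalTransform k c (fun t => g t) ≤
          K * zonalNormPow n p α₁ α₂ (fun t => g t) ^ (1 / p) := by
  obtain ⟨K, hK⟩ := h
  obtain ⟨C₁, hC₁, h1⟩ := exists_wNorm_zonal (n := n) (by omega) p α₁ α₂ hp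
  obtain ⟨C₂, hC₂, h2⟩ := exists_lintegral_induced hk1
  refine ⟨C₂⁻¹ * K * C₁, fun g hg hN a b ha hab hb => ?_⟩
  set G : ℝ → ℂ := fun t => ((g t : ℝ) : ℂ) with hG
  have hGm : Measurable G := by fun_prop
  have hGe : ∀ t, ‖G t‖ₑ = g t := fun t => by
    rw [← ofReal_norm, hG, Complex.norm_real, Real.norm_of_nonneg (g t).coe_nonneg,
      ENNReal.ofReal_coe_nnreal]
  have hw := h1 G hGm
  simp only [hGe] at hw
  obtain ⟨hex, hle⟩ := hK (fun x : Sph n => G ((x : Amb n) (Fin.last n)))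
    ⟨G, fun x => by rw [cos_dist0]⟩
    ⟨hGm.comp (by fun_prop), by
      rw [hw]
      exact (ENNReal.mul_ne_top ENNReal.coe_ne_top
        (ENNReal.rpow_ne_top_of_nonneg (by positivity) hN)).lt_top⟩
  rw [eLpNorm_exponent_top] at hle
  have hle0 := enorm_ae_le_eLpNormEssSup (fun ξ : Xi n k =>
    ((Real.sin (distXi ξ) ^ γ₁ * Real.cos (distXi ξ) ^ γ₂ : ℝ) : ℂ) *
      planeTransform k (fun x : Sph n => G ((x : Amb n) (Fin.last n))) ξ) (xiMeasure hk)
  obtain ⟨ξ, hξ, hex, hξle⟩ := xiMeasure_exists_height hk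
    (hex.and hle0) ha hab hb
  refine ⟨ξ.height, hξ, ?_⟩
  have hξ' : ξ.height ∈ Ioo (0 : ℝ) 1 := ⟨ha.trans_lt hξ.1, hξ.2.trans_le hb⟩
  have hle' := hξle.trans hle
  have hT := h2 n ξ hξ'.1 (fun t => (g t : ℝ≥0∞)) (by fun_prop)
  -- There is no cancellation for a non-negative function. Almost everywhere existence is needed
  -- here, because the Bochner integral of a non-integrable function is `0` and would carry no
  -- information.
  have hpl : ‖planeTransform k (fun x : Sph n => G ((x : Amb n) (Fin.last n))) ξ‖ₑ =
      C₂ * zonalTransform k ξ.height (fun t => g t) := by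
    rw [← hT, planeTransform]
    simp only [hG]
    rw [integral_complex_ofReal, ← ofReal_norm, Complex.norm_real, Real.norm_of_nonneg
      (integral_nonneg fun y => (g _).coe_nonneg), ofReal_integral_eq_lintegral_ofReal]
    · simp
    · have := hex.re
      simpa [hG] using this
    · exact Filter.Eventually.of_forall fun y => (g _).coe_nonneg
  rw [enorm_mul, hpl, hw, ξ.cos_distXi hξ', ξ.sin_distXi hξ'] at hle'
  have h4 : 0 < 1 - ξ.height ^ 2 := by nlinarith [hξ'.1, hξ'.2]
  have h5 := hξ'.1
  rw [← ofReal_norm, Complex.norm_real, Real.norm_of_nonneg (by positivity)] at hle'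
  have h6 : (C₂ : ℝ≥0∞)⁻¹ * C₂ = 1 :=
    ENNReal.inv_mul_cancel (by simpa using hC₂) ENNReal.coe_ne_top
  calc _ = (C₂ : ℝ≥0∞)⁻¹ * C₂ * (ENNReal.ofReal (√(1 - ξ.height ^ 2) ^ γ₁ * ξ.height ^ γ₂) *
        zonalTransform k ξ.height fun t => g t) := by rw [h6, one_mul]
    _ = (C₂ : ℝ≥0∞)⁻¹ * (ENNReal.ofReal (√(1 - ξ.height ^ 2) ^ γ₁ * ξ.height ^ γ₂) *
        (C₂ * zonalTransform k ξ.height fun t => g t)) := by ring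
    _ ≤ (C₂ : ℝ≥0∞)⁻¹ * (K * (C₁ * zonalNormPow n p α₁ α₂ (fun t => g t) ^ (1 / p))) := by
        gcongr
    _ = _ := by
        rw [ENNReal.coe_mul, ENNReal.coe_mul, ENNReal.coe_inv hC₂]
        ring

/-! ### Uniform estimates for the dual kernel -/

/-- The exponents have unknown sign, so a power may be increasing or decreasing; the maximum of the
endpoint values covers both cases. -/
lemma rpow_le_max_rpow {l u y : ℝ} (e : ℝ) (hl : 0 < l) (hy : l ≤ y) (hu : y ≤ u) :
    y ^ e ≤ max (l ^ e) (u ^ e) := by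
  rcases le_total 0 e with he | he
  · exact le_max_of_le_right (Real.rpow_le_rpow (hl.le.trans hy) hu he)
  · exact le_max_of_le_left (Real.rpow_le_rpow_of_nonpos hl hy he)

lemma setLIntegral_comp_mul_left {c : ℝ} (hc : 0 < c) (a b : ℝ) (F : ℝ → ℝ≥0∞) :
    ∫⁻ t in Ioo (c * a) (c * b), F t = ENNReal.ofReal c * ∫⁻ s in Ioo a b, F (c * s) := by
  rw [← image_mul_left_Ioo hc, lintegral_image_eq_lintegral_abs_deriv_mul (f' := fun _ => c)
    measurableSet_Ioo (fun x _ => by simpa using ((hasDerivAt_id x).const_mul c).hasDerivWithinAt)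
    (mul_right_injective₀ hc.ne').injOn, ← lintegral_const_mul' _ _ ENNReal.ofReal_ne_top]
  simp only [abs_of_pos hc]

lemma setLIntegral_comp_one_sub (F : ℝ → ℝ≥0∞) :
    ∫⁻ s in Ioo (0 : ℝ) 1, F (1 - s) = ∫⁻ s in Ioo (0 : ℝ) 1, F s := by
  have h : (fun s : ℝ => 1 - s) '' Ioo 0 1 = Ioo 0 1 := by simp
  conv_rhs => rw [← h]
  rw [lintegral_image_eq_lintegral_abs_deriv_mul (f' := fun _ => -1) measurableSet_Ioo
    (fun x _ => by simpa using ((hasDerivAt_id x).const_sub 1).hasDerivWithinAt)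
    sub_right_injective.injOn]
  simp

lemma setLIntegral_comp_abs (F : ℝ → ℝ≥0∞) :
    ∫⁻ s in Ioo (-1 : ℝ) 1, F |s| = 2 * ∫⁻ s in Ioo (0 : ℝ) 1, F s := by
  have h1 : ∫⁻ s in Ioo (0 : ℝ) 1, F |s| = ∫⁻ s in Ioo (0 : ℝ) 1, F s :=
    setLIntegral_congr_fun measurableSet_Ioo fun s hs => by simp only [abs_of_pos hs.1]
  have h2 : ∫⁻ s in Ioo (-1 : ℝ) 0, F |s| = ∫⁻ s in Ioo (0 : ℝ) 1, F s := by
    have h : (fun s : ℝ => -s) '' Ioo 0 1 = Ioo (-1) 0 := by simp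
    rw [← h, lintegral_image_eq_lintegral_abs_deriv_mul (f' := fun _ => -1) measurableSet_Ioo
      (fun x _ => (hasDerivAt_neg x).hasDerivWithinAt) neg_injective.injOn, ← h1]
    simp
  have h3 : Ioo (-1 : ℝ) 1 =ᵐ[volume] (Ioo (-1) 0 ∪ Ioo 0 1 : Set ℝ) := by
    have hne : ∀ᵐ s : ℝ, s ≠ 0 := by simp [ae_iff]
    filter_upwards [hne] with s hs
    refine propext ⟨fun h => ?_, ?_⟩
    · rcases lt_or_gt_of_ne hs with h0 | h0
      · exact Or.inl ⟨h.1, h0⟩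
      · exact Or.inr ⟨h0, h.2⟩
    · rintro (h | h)
      · exact ⟨h.1, h.2.trans one_pos⟩
      · exact ⟨by linarith [h.1], h.2⟩
  rw [setLIntegral_congr h3, lintegral_union measurableSet_Ioo, h1, h2, two_mul]
  exact disjoint_left.2 fun s hs hs' => (hs.2.trans hs'.1).false

lemma setLIntegral_rpow_ne_top {e : ℝ} (he : -1 < e) :
    ∫⁻ x in Ioo (0 : ℝ) 1, ENNReal.ofReal (x ^ e) ≠ ∞ :=
  ((intervalIntegral.integrableOn_Ioo_rpow_iff one_pos).2 he).lintegral_lt_top.ne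

lemma setLIntegral_rpow_mul_max_rpow_ne_top {a b : ℝ} (ha : -1 < a) (hb : a + 1 < b) :
    ∫⁻ y in Ioi (0 : ℝ), ENNReal.ofReal (y ^ a * max 1 y ^ (-b)) ≠ ∞ := by
  have h : Ioi (0 : ℝ) =ᵐ[volume] (Ioo 0 1 ∪ Ioi 1 : Set ℝ) := by
    have hne : ∀ᵐ s : ℝ, s ≠ 1 := by simp [ae_iff]
    filter_upwards [hne] with s hs
    refine propext ⟨fun h => ?_, ?_⟩
    · rcases lt_or_gt_of_ne hs with h0 | h0
      · exact Or.inl ⟨h, h0⟩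
      · exact Or.inr h0
    · rintro (h | h)
      · exact h.1
      · exact one_pos.trans h
  rw [setLIntegral_congr h, lintegral_union measurableSet_Ioi, ENNReal.add_ne_top]
  · constructor
    · rw [setLIntegral_congr_fun (g := fun y => ENNReal.ofReal (y ^ a)) measurableSet_Ioo]
      · exact setLIntegral_rpow_ne_top ha
      · intro y hy
        simp [max_eq_left hy.2.le]
    · rw [setLIntegral_congr_fun (g := fun y => ENNReal.ofReal (y ^ (a - b))) measurableSet_Ioi]
      · exact (integrableOn_Ioi_rpow_of_lt (by linarith) one_pos).lintegral_lt_top.ne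
      · intro y hy
        have hy0 : (0 : ℝ) < y := one_pos.trans hy
        simp only [max_eq_right (mem_Ioi.1 hy).le]
        rw [← Real.rpow_add hy0, sub_eq_add_neg]
  · exact disjoint_left.2 fun s hs hs' => (hs.2.trans hs').false

/-- A one-sided model of the kernel near the boundary of the ball of directions. -/
lemma exists_bound_boundary_layer {a B Γ : ℝ} (ha : -1 < a) (hΓ : 0 ≤ Γ) (hΓB : B - a - 1 ≤ Γ)
    (hend : B = a + 1 → 0 < Γ) :
    ∃ b : ℝ, 0 ≤ b ∧ B ≤ b ∧ ∃ K : ℝ≥0∞, K ≠ ∞ ∧ ∀ τ ∈ Ioo (0 : ℝ) 1,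
      ∫⁻ x in Ioo (0 : ℝ) 1, ENNReal.ofReal (τ ^ Γ * (x ^ a * max τ x ^ (-b))) ≤ K := by
  -- Without the factor `τ^Γ` the integral must converge at `τ = 0`. This is `B < a + 1`, since
  -- `hend` excludes equality. Replacing `B` by `max B 0` makes the power monotone.
  rcases hΓ.eq_or_lt with h0 | h0
  · have hB : B < a + 1 := lt_of_le_of_ne (by linarith) fun h => by
      have := hend h
      linarith
    have hB' : max B 0 < a + 1 := max_lt hB (by linarith)
    refine ⟨max B 0, le_max_right _ _, le_max_left _ _, _,
      setLIntegral_rpow_ne_top (e := a - max B 0) (by linarith), fun τ hτ => ?_⟩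
    refine setLIntegral_mono (by fun_prop) fun x hx => ENNReal.ofReal_le_ofReal ?_
    rw [← h0, Real.rpow_zero, one_mul, sub_eq_add_neg, Real.rpow_add hx.1]
    refine mul_le_mul_of_nonneg_left ?_ (Real.rpow_nonneg hx.1.le _)
    exact Real.rpow_le_rpow_of_nonpos hx.1 (le_max_right _ _) (by simp)
  -- Raising `B` to the critical exponent `b = Γ + a + 1` makes the integral scale invariant: under
  -- `x = τy` all powers of `τ` cancel, and the integral over `(0, ∞)` converges because `a > -1`
  -- and `b > a + 1`. The case `B = a + 1` is thereby included.
  · refine ⟨Γ + a + 1, by linarith, by linarith, _,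
      setLIntegral_rpow_mul_max_rpow_ne_top (b := Γ + a + 1) ha (by linarith), fun τ hτ => ?_⟩
    have hsub : Ioo (0 : ℝ) 1 = Ioo (τ * 0) (τ * τ⁻¹) := by
      rw [mul_zero, mul_inv_cancel₀ hτ.1.ne']
    rw [hsub, setLIntegral_comp_mul_left hτ.1, ← lintegral_const_mul' _ _ ENNReal.ofReal_ne_top]
    refine le_trans (le_of_eq ?_) (lintegral_mono_set (Ioo_subset_Ioi_self : Ioo 0 τ⁻¹ ⊆ Ioi 0))
    refine setLIntegral_congr_fun measurableSet_Ioo fun y hy => ?_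
    have h1 : max τ (τ * y) = τ * max 1 y := by rw [mul_max_of_nonneg _ _ hτ.1.le, mul_one]
    have h2 : (0 : ℝ) < max 1 y := lt_max_of_lt_left one_pos
    simp only [h1]
    rw [← ENNReal.ofReal_mul hτ.1.le, Real.mul_rpow hτ.1.le hy.1.le, Real.mul_rpow hτ.1.le h2.le]
    congr 1
    have h3 : τ * τ ^ Γ * τ ^ a * τ ^ (-(Γ + a + 1)) = 1 := by
      nth_rw 1 [← Real.rpow_one τ]
      rw [← Real.rpow_add hτ.1, ← Real.rpow_add hτ.1, ← Real.rpow_add hτ.1,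
        show 1 + Γ + a + -(Γ + a + 1) = 0 by ring, Real.rpow_zero]
    linear_combination (y ^ a * max 1 y ^ (-(Γ + a + 1))) * h3

/-- The uniform bound of the kernel that is dual to the weighted norm. -/
lemma exists_bound_kernel {a B D Γ : ℝ} (ha : -1 < a) (hD : D < 1) (hΓ : 0 ≤ Γ)
    (hΓB : B - a - 1 ≤ Γ) (hend : B = a + 1 → 0 < Γ) :
    ∃ K : ℝ≥0∞, K ≠ ∞ ∧ ∀ c ∈ Ioo (0 : ℝ) 1, ∫⁻ s in Ioo (-1 : ℝ) 1,
      ENNReal.ofReal ((1 - c ^ 2) ^ Γ * ((1 - s ^ 2) ^ a * (1 - (c * s) ^ 2) ^ (-B) * |s| ^ (-D)))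
        ≤ K := by
  obtain ⟨b, hb0, hBb, K₀, hK₀, hK⟩ := exists_bound_boundary_layer ha hΓ hΓB hend
  set M₁ : ℝ := max ((3 / 4 : ℝ) ^ a) (1 ^ a) * max ((3 / 4 : ℝ) ^ (-B)) (1 ^ (-B)) with hM₁
  set M₂ : ℝ := max (1 ^ a) ((2 : ℝ) ^ a) * max ((1 / 2 : ℝ) ^ (-D)) (1 ^ (-D)) with hM₂
  have hM₁0 : 0 ≤ M₁ := by positivity
  have hM₂0 : 0 ≤ M₂ := by positivity
  -- The first term controls `|s| ≤ 1/2`, where only `|s|^(-D)` can be singular; the second controls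
  -- `|s| ≥ 1/2`, where the boundary layer model applies. The factors `2` come from evenness in `s`.
  refine ⟨2 * (ENNReal.ofReal M₁ * ∫⁻ x in Ioo (0 : ℝ) 1, ENNReal.ofReal (x ^ (-D))) +
    2 * (ENNReal.ofReal M₂ * K₀), ?_, fun c hc => ?_⟩
  · refine ENNReal.add_ne_top.2 ⟨?_, ?_⟩
    · exact ENNReal.mul_ne_top (by simp) (ENNReal.mul_ne_top ENNReal.ofReal_ne_top
        (setLIntegral_rpow_ne_top (by linarith)))
    · exact ENNReal.mul_ne_top (by simp) (ENNReal.mul_ne_top ENNReal.ofReal_ne_top hK₀)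
  set τ : ℝ := 1 - c ^ 2 with hτ
  have hτ1 : τ ∈ Ioo (0 : ℝ) 1 := ⟨by nlinarith [hc.1, hc.2], by nlinarith [hc.1]⟩
  have key : ∀ s ∈ Ioo (0 : ℝ) 1,
      τ ^ Γ * ((1 - s ^ 2) ^ a * (1 - (c * s) ^ 2) ^ (-B) * s ^ (-D)) ≤
        M₁ * s ^ (-D) + M₂ * (τ ^ Γ * ((1 - s) ^ a * max τ (1 - s) ^ (-b))) := by
    intro s hs
    have hs0 := hs.1
    have hx : 0 < 1 - s := by linarith [hs.2]
    have hv : 1 - s ^ 2 = (1 - s) * (1 + s) := by ring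
    have hcs : c * s < 1 := by nlinarith [hc.1, hc.2, hs.2]
    have hcs0 : 0 < c * s := mul_pos hc.1 hs0
    have hm0 : 0 < 1 - (c * s) ^ 2 := by nlinarith
    have hm1 : 1 - (c * s) ^ 2 ≤ 1 := by nlinarith
    have hτ0 := hτ1.1
    have hτΓ : τ ^ Γ ≤ 1 := Real.rpow_le_one hτ0.le hτ1.2.le hΓ
    have hτΓ0 : 0 < τ ^ Γ := Real.rpow_pos_of_pos hτ0 _
    have hmax0 : 0 < max τ (1 - s) := lt_max_of_lt_left hτ0
    rcases le_total s (1 / 2) with h | h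
    · refine le_trans ?_ (le_add_of_nonneg_right (by positivity))
      have e1 : (1 - s ^ 2) ^ a ≤ max ((3 / 4 : ℝ) ^ a) (1 ^ a) :=
        rpow_le_max_rpow a (by norm_num) (by nlinarith) (by nlinarith)
      have e2 : (1 - (c * s) ^ 2) ^ (-B) ≤ max ((3 / 4 : ℝ) ^ (-B)) (1 ^ (-B)) := by
        have : c * s ≤ 1 / 2 := by nlinarith [hc.1, hc.2]
        exact rpow_le_max_rpow _ (by norm_num) (by nlinarith) hm1
      have e3 : 0 < 1 - s ^ 2 := by nlinarith
      calc τ ^ Γ * ((1 - s ^ 2) ^ a * (1 - (c * s) ^ 2) ^ (-B) * s ^ (-D))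
          ≤ 1 * ((1 - s ^ 2) ^ a * (1 - (c * s) ^ 2) ^ (-B) * s ^ (-D)) := by gcongr
        _ ≤ M₁ * s ^ (-D) := by rw [one_mul, hM₁]; gcongr
    · refine le_trans ?_ (le_add_of_nonneg_left (by positivity))
      have e1 : (1 - s ^ 2) ^ a ≤ max (1 ^ a) ((2 : ℝ) ^ a) * (1 - s) ^ a := by
        rw [hv, Real.mul_rpow hx.le (by linarith), mul_comm]
        gcongr
        exact rpow_le_max_rpow a one_pos (by linarith) (by linarith [hs.2])
      have e2 : s ^ (-D) ≤ max ((1 / 2 : ℝ) ^ (-D)) (1 ^ (-D)) :=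
        rpow_le_max_rpow _ (by norm_num) h hs.2.le
      -- Raising `B` to `b` enlarges the power since the base is at most `1`. Then `1-(cs)²` is at
      -- least both `1-c² = τ` and `1-s`, and `b ≥ 0` reverses this bound.
      have e3 : (1 - (c * s) ^ 2) ^ (-B) ≤ max τ (1 - s) ^ (-b) := by
        calc (1 - (c * s) ^ 2) ^ (-B) ≤ (1 - (c * s) ^ 2) ^ (-b) :=
              Real.rpow_le_rpow_of_exponent_ge hm0 hm1 (by linarith)
          _ ≤ _ := by
              refine Real.rpow_le_rpow_of_nonpos hmax0 (max_le ?_ ?_) (by linarith)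
              · rw [hτ]
                have : c * s ≤ c := by nlinarith [hc.1, hs.2]
                nlinarith [hc.1]
              · have : c * s ≤ s := by nlinarith [hc.2]
                nlinarith
      calc τ ^ Γ * ((1 - s ^ 2) ^ a * (1 - (c * s) ^ 2) ^ (-B) * s ^ (-D))
          ≤ τ ^ Γ * ((max (1 ^ a) ((2 : ℝ) ^ a) * (1 - s) ^ a) * max τ (1 - s) ^ (-b) *
              max ((1 / 2 : ℝ) ^ (-D)) (1 ^ (-D))) := by gcongr
        _ = _ := by rw [hM₂]; ring
  have habs : ∀ s : ℝ, (1 - s ^ 2) ^ a * (1 - (c * s) ^ 2) ^ (-B) * |s| ^ (-D) =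
      (1 - |s| ^ 2) ^ a * (1 - (c * |s|) ^ 2) ^ (-B) * |s| ^ (-D) := fun s => by
    rw [mul_pow, mul_pow, sq_abs]
  simp only [habs]
  rw [setLIntegral_comp_abs fun s =>
    ENNReal.ofReal (τ ^ Γ * ((1 - s ^ 2) ^ a * (1 - (c * s) ^ 2) ^ (-B) * s ^ (-D))), ← mul_add]
  refine mul_le_mul_right (le_trans (setLIntegral_mono (g := fun s =>
    ENNReal.ofReal M₁ * ENNReal.ofReal (s ^ (-D)) + ENNReal.ofReal M₂ *
      ENNReal.ofReal (τ ^ Γ * ((1 - s) ^ a * max τ (1 - s) ^ (-b)))) (by fun_prop) ?_) ?_) _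
  · intro s hs
    have hx : 0 < 1 - s := by linarith [hs.2]
    have hmax0 : 0 < max τ (1 - s) := lt_max_of_lt_right hx
    have hs0 := hs.1
    have hτ0 := hτ1.1
    rw [← ENNReal.ofReal_mul hM₁0, ← ENNReal.ofReal_mul hM₂0,
      ← ENNReal.ofReal_add (by positivity) (by positivity)]
    exact ENNReal.ofReal_le_ofReal (key s hs)
  · rw [lintegral_add_left (by fun_prop), lintegral_const_mul' _ _ ENNReal.ofReal_ne_top,
      lintegral_const_mul' _ _ ENNReal.ofReal_ne_top]
    gcongr
    rw [setLIntegral_comp_one_sub fun x => ENNReal.ofReal (τ ^ Γ * (x ^ a * max τ x ^ (-b)))]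
    exact hK τ hτ1

/-! ### Sufficiency: Hölder's inequality, and pointwise comparison for `p = 1` -/

/-- Hölder's inequality for the factors `G U^(1/p)` and `w U^(-1/p)`. Positivity is asked only
almost everywhere, because the weight `|s|^α₂` may degenerate at `s = 0`. -/
lemma lintegral_mul_le_weighted {p q : ℝ} (hpq : p.HolderConjugate q) (μ : Measure ℝ)
    {G : ℝ → ℝ≥0∞} {w U : ℝ → ℝ} (hG : Measurable G) (hw : Measurable w) (hU : Measurable U)
    (hw0 : ∀ᵐ s ∂μ, 0 ≤ w s) (hU0 : ∀ᵐ s ∂μ, 0 < U s) :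
    ∫⁻ s, G s * ENNReal.ofReal (w s) ∂μ ≤ (∫⁻ s, G s ^ p * ENNReal.ofReal (U s) ∂μ) ^ (1 / p) *
      (∫⁻ s, ENNReal.ofReal (w s ^ q * U s ^ (-(q / p))) ∂μ) ^ (1 / q) := by
  have hp := hpq.pos
  have hq := hpq.symm.pos
  have h := ENNReal.lintegral_mul_le_Lp_mul_Lq μ hpq
    (f := fun s => G s * ENNReal.ofReal (U s ^ (1 / p)))
    (g := fun s => ENNReal.ofReal (w s * U s ^ (-(1 / p)))) (by fun_prop) (by fun_prop)
  refine le_of_eq_of_le (lintegral_congr_ae ?_) (h.trans_eq ?_)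
  · filter_upwards [hw0, hU0] with s h1 h2
    simp only [Pi.mul_apply]
    rw [mul_assoc, ← ENNReal.ofReal_mul (by positivity), mul_left_comm, ← Real.rpow_add h2]
    simp
  · congr 2
    · refine lintegral_congr_ae ?_
      filter_upwards [hU0] with s h2
      rw [ENNReal.mul_rpow_of_nonneg _ _ hp.le, ENNReal.ofReal_rpow_of_nonneg (by positivity) hp.le,
        ← Real.rpow_mul h2.le, one_div_mul_cancel hp.ne', Real.rpow_one]
    · refine lintegral_congr_ae ?_
      filter_upwards [hw0, hU0] with s h1 h2
      rw [ENNReal.ofReal_rpow_of_nonneg (by positivity) hq.le, Real.mul_rpow h1 (by positivity),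
        ← Real.rpow_mul h2.le]
      ring_nf

/-- Under `t = cs` the left side is the norm integral restricted to `(-c, c)`; the leading factor
`c` is the Jacobian. -/
lemma le_zonalNormPow {n : ℕ} {p α₁ α₂ c : ℝ} (hc : c ∈ Ioo (0 : ℝ) 1) (g : ℝ → ℝ≥0∞) :
    ∫⁻ s in Ioo (-1 : ℝ) 1, g (c * s) ^ p *
        ENNReal.ofReal (c * ((1 - (c * s) ^ 2) ^ ((α₁ + n - 2) / 2) * |c * s| ^ α₂)) ≤
      zonalNormPow n p α₁ α₂ g := by
  have hsub : Ioo (c * (-1)) (c * 1) ⊆ Ioo (-1 : ℝ) 1 :=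
    Ioo_subset_Ioo (by linarith [hc.2]) (by linarith [hc.2])
  refine le_trans (le_of_eq ?_) (lintegral_mono_set hsub)
  rw [setLIntegral_comp_mul_left hc.1, ← lintegral_const_mul' _ _ ENNReal.ofReal_ne_top]
  refine lintegral_congr fun s => ?_
  rw [ENNReal.ofReal_mul hc.1.le]
  ring

lemma ae_restrict_ne_zero : ∀ᵐ s ∂(volume.restrict (Ioo (-1 : ℝ) 1)), s ∈ Ioo (-1 : ℝ) 1 ∧ s ≠ 0 := by
  have hne : ∀ᵐ s : ℝ, s ≠ 0 := by simp [ae_iff]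
  filter_upwards [ae_restrict_mem measurableSet_Ioo, ae_restrict_of_ae hne] with s h1 h2
  exact ⟨h1, h2⟩

lemma one_sub_sq_mul_pos {c s : ℝ} (hc : c ∈ Ioo (0 : ℝ) 1) (hs : s ∈ Ioo (-1 : ℝ) 1) :
    0 < 1 - (c * s) ^ 2 := by
  have h1 : (c * s) ^ 2 = c ^ 2 * s ^ 2 := mul_pow _ _ _
  have h2 : s ^ 2 < 1 := by nlinarith [hs.1, hs.2]
  have h3 : c ^ 2 < 1 := by nlinarith [hc.1, hc.2]
  nlinarith [sq_nonneg c, sq_nonneg s]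

/-- The zonal inequality for `p > 1`. -/
theorem exists_zonal_bound_of_one_lt {n k : ℕ} {p α₁ α₂ γ₁ γ₂ : ℝ} (hp : 1 < p) (hα : α₂ < p - 1)
    (hkp : -1 < ((k : ℝ) - 2) / 2 * (p / (p - 1))) (h0 : 0 ≤ γ₁) (h1 : (α₁ + n) / p - k ≤ γ₁)
    (h2 : (1 + α₂) / p ≤ γ₂) (hend : (α₁ + n) / p = k → 0 < γ₁) :
    ∃ K : ℝ≥0, ∀ g : ℝ → ℝ≥0∞, Measurable g → ∀ c ∈ Ioo (0 : ℝ) 1,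
      ENNReal.ofReal (√(1 - c ^ 2) ^ γ₁ * c ^ γ₂) * zonalTransform k c g ≤
        K * zonalNormPow n p α₁ α₂ g ^ (1 / p) := by
  have hp0 : 0 < p := by linarith
  have hr : 0 < p - 1 := by linarith
  set q : ℝ := p / (p - 1) with hq
  have hpq : p.HolderConjugate q := Real.HolderConjugate.conjExponent hp
  have hq0 : 0 < q := hpq.symm.pos
  have hqp : q / p = 1 / (p - 1) := by rw [hq]; field_simp
  -- This identifies `B - a - 1` in the kernel bound, so that its condition on `Γ = γ₁ q / 2` is
  -- exactly `γ₁ ≥ (α₁+n)/p - k`, and its endpoint `B = a + 1` is `(α₁+n)/p = k`.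
  have e1 : (α₁ + n - 2) / 2 * (q / p) - ((k : ℝ) - 2) / 2 * q - 1 =
      ((α₁ + n) / p - k) * q / 2 := by
    rw [hqp, hq]
    field_simp
    ring
  obtain ⟨K, hK, hKc⟩ := exists_bound_kernel (a := ((k : ℝ) - 2) / 2 * q)
    (B := (α₁ + n - 2) / 2 * (q / p)) (D := α₂ * (q / p)) (Γ := γ₁ * q / 2) hkp
    (by rw [hqp, mul_one_div, div_lt_one hr]; exact hα) (by positivity)
    (by rw [e1]; gcongr)
    (fun h => by
      have h3 : ((α₁ + n) / p - k) * q / 2 = 0 := by rw [← e1]; linarith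
      have h4 : (α₁ + n) / p - k = 0 := by
        rcases mul_eq_zero.1 (div_eq_zero_iff.1 h3 |>.resolve_right two_ne_zero) with h | h
        · exact h
        · exact absurd h hq0.ne'
      have := hend (by linarith)
      positivity)
  refine ⟨(K ^ (1 / q)).toNNReal, fun g hg c hc => ?_⟩
  rw [ENNReal.coe_toNNReal (ENNReal.rpow_ne_top_of_nonneg (by positivity) hK)]
  have hc0 := hc.1
  have hτ : 0 < 1 - c ^ 2 := by nlinarith [hc.1, hc.2]
  set κ : ℝ := √(1 - c ^ 2) ^ γ₁ * c ^ γ₂ with hκ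
  have hκ0 : 0 < κ := by positivity
  set w : ℝ → ℝ := fun s => (1 - s ^ 2) ^ (((k : ℝ) - 2) / 2) with hw
  set U : ℝ → ℝ := fun s => c * ((1 - (c * s) ^ 2) ^ ((α₁ + n - 2) / 2) * |c * s| ^ α₂) with hU
  have hw0 : ∀ᵐ s ∂(volume.restrict (Ioo (-1 : ℝ) 1)), 0 ≤ w s := by
    filter_upwards [ae_restrict_ne_zero] with s hs
    have : 0 < 1 - s ^ 2 := by nlinarith [hs.1.1, hs.1.2]
    simp only [hw]
    positivity
  have hU0 : ∀ᵐ s ∂(volume.restrict (Ioo (-1 : ℝ) 1)), 0 < U s := by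
    filter_upwards [ae_restrict_ne_zero] with s hs
    have h3 := one_sub_sq_mul_pos hc hs.1
    have h4 : 0 < |c * s| := abs_pos.2 (mul_ne_zero hc0.ne' hs.2)
    simp only [hU]
    positivity
  have hH := lintegral_mul_le_weighted hpq (volume.restrict (Ioo (-1 : ℝ) 1))
    (G := fun s => g (c * s)) (w := w) (U := U) (by fun_prop) (by fun_prop) (by fun_prop) hw0 hU0
  have hdual : ENNReal.ofReal κ * (∫⁻ s in Ioo (-1 : ℝ) 1,
      ENNReal.ofReal (w s ^ q * U s ^ (-(q / p)))) ^ (1 / q) ≤ K ^ (1 / q) := by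
    have h3 : ENNReal.ofReal κ = (ENNReal.ofReal (κ ^ q)) ^ (1 / q) := by
      rw [ENNReal.ofReal_rpow_of_nonneg (by positivity) (by positivity), ← Real.rpow_mul hκ0.le,
        mul_one_div_cancel hq0.ne', Real.rpow_one]
    rw [h3, ← ENNReal.mul_rpow_of_nonneg _ _ (by positivity),
      ← lintegral_const_mul' _ _ ENNReal.ofReal_ne_top]
    refine ENNReal.rpow_le_rpow (le_trans (lintegral_mono_ae ?_) (hKc c hc)) (by positivity)
    filter_upwards [ae_restrict_ne_zero] with s hs
    have hm := one_sub_sq_mul_pos hc hs.1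
    have hv : 0 < 1 - s ^ 2 := by nlinarith [hs.1.1, hs.1.2]
    have hs0 : 0 < |s| := abs_pos.2 hs.2
    rw [← ENNReal.ofReal_mul (by positivity)]
    refine ENNReal.ofReal_le_ofReal ?_
    have e2 : κ ^ q = (1 - c ^ 2) ^ (γ₁ * q / 2) * c ^ (γ₂ * q) := by
      rw [hκ, Real.mul_rpow (by positivity) (by positivity), ← Real.rpow_mul (by positivity),
        ← Real.rpow_mul hc0.le, Real.sqrt_eq_rpow, ← Real.rpow_mul hτ.le]
      ring_nf
    have e3 : w s ^ q = (1 - s ^ 2) ^ (((k : ℝ) - 2) / 2 * q) := by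
      rw [hw, ← Real.rpow_mul hv.le]
    have e4 : U s ^ (-(q / p)) = c ^ (-((1 + α₂) * (q / p))) *
        ((1 - (c * s) ^ 2) ^ (-((α₁ + n - 2) / 2 * (q / p))) * |s| ^ (-(α₂ * (q / p)))) := by
      simp only [hU]
      rw [abs_mul, abs_of_pos hc0, Real.mul_rpow hc0.le hs0.le,
        Real.mul_rpow hc0.le (by positivity), Real.mul_rpow (by positivity) (by positivity),
        Real.mul_rpow (by positivity) (by positivity), ← Real.rpow_mul hm.le,
        ← Real.rpow_mul hc0.le, ← Real.rpow_mul hs0.le,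
        show -((1 + α₂) * (q / p)) = -(q / p) + α₂ * -(q / p) by ring, Real.rpow_add hc0]
      ring_nf
    -- The only use of the condition on `γ₂`: the net power of `c` is non-negative and `c < 1`.
    have e5 : c ^ (γ₂ * q) * c ^ (-((1 + α₂) * (q / p))) ≤ 1 := by
      rw [← Real.rpow_add hc0]
      refine Real.rpow_le_one hc0.le hc.2.le ?_
      have : (1 + α₂) * (q / p) = (1 + α₂) / p * q := by ring
      rw [this, ← sub_eq_add_neg, ← sub_mul]
      exact mul_nonneg (by linarith) hq0.le
    rw [e2, e3, e4]
    calc _ = (c ^ (γ₂ * q) * c ^ (-((1 + α₂) * (q / p)))) * ((1 - c ^ 2) ^ (γ₁ * q / 2) *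
          ((1 - s ^ 2) ^ (((k : ℝ) - 2) / 2 * q) *
            (1 - (c * s) ^ 2) ^ (-((α₁ + n - 2) / 2 * (q / p))) * |s| ^ (-(α₂ * (q / p))))) := by
          ring
      _ ≤ _ := mul_le_of_le_one_left (by positivity) e5
  calc ENNReal.ofReal κ * zonalTransform k c g
      ≤ ENNReal.ofReal κ * (zonalNormPow n p α₁ α₂ g ^ (1 / p) * (∫⁻ s in Ioo (-1 : ℝ) 1,
          ENNReal.ofReal (w s ^ q * U s ^ (-(q / p)))) ^ (1 / q)) := by
        refine mul_le_mul_right (hH.trans ?_) _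
        gcongr
        exact le_zonalNormPow hc g
    _ = ENNReal.ofReal κ * (∫⁻ s in Ioo (-1 : ℝ) 1,
          ENNReal.ofReal (w s ^ q * U s ^ (-(q / p)))) ^ (1 / q) *
            zonalNormPow n p α₁ α₂ g ^ (1 / p) := by ring
    _ ≤ _ := by gcongr

/-- The zonal inequality for `p = 1`. -/
theorem zonal_bound_one {n k : ℕ} (hk : 2 ≤ k) {α₁ α₂ γ₁ γ₂ : ℝ} (hα : α₂ ≤ 0)
    (h0 : 0 ≤ γ₁) (h1 : α₁ + n - k ≤ γ₁) (h2 : 1 + α₂ ≤ γ₂) (g : ℝ → ℝ≥0∞) {c : ℝ}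
    (hc : c ∈ Ioo (0 : ℝ) 1) :
    ENNReal.ofReal (√(1 - c ^ 2) ^ γ₁ * c ^ γ₂) * zonalTransform k c g ≤
      zonalNormPow n 1 α₁ α₂ g := by
  refine le_trans ?_ (le_zonalNormPow hc g)
  rw [zonalTransform, ← lintegral_const_mul' _ _ ENNReal.ofReal_ne_top]
  refine lintegral_mono_ae ?_
  have hc0 := hc.1
  have hτ : 0 < 1 - c ^ 2 := by nlinarith [hc.1, hc.2]
  filter_upwards [ae_restrict_ne_zero] with s hs
  have hm := one_sub_sq_mul_pos hc hs.1
  have hv : 0 < 1 - s ^ 2 := by nlinarith [hs.1.1, hs.1.2]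
  have hs0 : 0 < |s| := abs_pos.2 hs.2
  have hs1 : |s| ≤ 1 := (abs_lt.2 hs.1).le
  have hs2 : s ^ 2 ≤ 1 := by nlinarith [hs.1.1, hs.1.2]
  have hc2 : c ^ 2 ≤ 1 := by nlinarith [hc.1, hc.2]
  have hk' : (0 : ℝ) ≤ ((k : ℝ) - 2) / 2 := by
    have : (2 : ℝ) ≤ k := by exact_mod_cast hk
    linarith
  rw [ENNReal.rpow_one, mul_left_comm, ← ENNReal.ofReal_mul (by positivity)]
  refine mul_le_mul_right (ENNReal.ofReal_le_ofReal ?_) _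
  set m : ℝ := 1 - (c * s) ^ 2 with hmdef
  have hm1 : m ≤ 1 := by rw [hmdef]; nlinarith [sq_nonneg (c * s)]
  have hvm : 1 - s ^ 2 ≤ m := by
    rw [hmdef, mul_pow]
    nlinarith [sq_nonneg s]
  have hτm : 1 - c ^ 2 ≤ m := by
    rw [hmdef, mul_pow]
    nlinarith [sq_nonneg c]
  -- Both `1-c²` and `1-s²` are at most `m ≤ 1`. Their exponents are non-negative because `γ₁ ≥ 0`
  -- and `k ≥ 2`, and they add up to at least `(α₁+n-2)/2`.
  have e1 : √(1 - c ^ 2) ^ γ₁ * (1 - s ^ 2) ^ (((k : ℝ) - 2) / 2) ≤ m ^ ((α₁ + n - 2) / 2) := by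
    rw [Real.sqrt_eq_rpow, ← Real.rpow_mul hτ.le]
    calc (1 - c ^ 2) ^ (1 / 2 * γ₁) * (1 - s ^ 2) ^ (((k : ℝ) - 2) / 2)
        ≤ m ^ (1 / 2 * γ₁) * m ^ (((k : ℝ) - 2) / 2) := by gcongr
      _ = m ^ (1 / 2 * γ₁ + ((k : ℝ) - 2) / 2) := (Real.rpow_add hm _ _).symm
      _ ≤ _ := Real.rpow_le_rpow_of_exponent_ge hm hm1 (by linarith)
  have e2 : c ^ γ₂ ≤ c * |c * s| ^ α₂ := by
    rw [abs_mul, abs_of_pos hc0, Real.mul_rpow hc0.le hs0.le, ← mul_assoc]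
    have : c * c ^ α₂ = c ^ (1 + α₂) := by rw [Real.rpow_add hc0, Real.rpow_one]
    rw [this]
    calc c ^ γ₂ ≤ c ^ (1 + α₂) := Real.rpow_le_rpow_of_exponent_ge hc0 hc.2.le h2
      _ ≤ _ := le_mul_of_one_le_right (by positivity)
          (Real.one_le_rpow_of_pos_of_le_one_of_nonpos hs0 hs1 hα)
  calc √(1 - c ^ 2) ^ γ₁ * c ^ γ₂ * (1 - s ^ 2) ^ (((k : ℝ) - 2) / 2)
      = (√(1 - c ^ 2) ^ γ₁ * (1 - s ^ 2) ^ (((k : ℝ) - 2) / 2)) * c ^ γ₂ := by ring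
    _ ≤ m ^ ((α₁ + n - 2) / 2) * (c * |c * s| ^ α₂) := by gcongr
    _ = _ := by ring

theorem radialBound_of_exponents {n k : ℕ} (hk1 : 1 ≤ k) (hkn : k < n) {α₁ α₂ γ₁ γ₂ p : ℝ}
    (hp : max 1 (1 + α₂) ≤ p) (hp' : 0 < α₂ → 1 + α₂ < p) (hend : p = (α₁ + n) / k → 0 < γ₁)
    (hγ₁ : max 0 ((α₁ + n) / p - k) ≤ γ₁) (hγ₂ : (1 + α₂) / p ≤ γ₂) (hkp : 2 ≤ k ∨ 2 < p) :
    RadialBound hkn p α₁ α₂ γ₁ γ₂ := by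
  have hp1 : 1 ≤ p := (le_max_left _ _).trans hp
  have hp2 : 1 + α₂ ≤ p := (le_max_right _ _).trans hp
  have h0 : 0 ≤ γ₁ := (le_max_left _ _).trans hγ₁
  have h1 : (α₁ + n) / p - k ≤ γ₁ := (le_max_right _ _).trans hγ₁
  refine radialBound_of_zonal hk1 hkn (by linarith) ?_
  rcases hp1.eq_or_lt with rfl | hp1
  · have hk2 : 2 ≤ k := hkp.resolve_right (by norm_num)
    refine ⟨1, fun g _ c hc => ?_⟩
    simp only [div_one] at h1 hγ₂
    simpa using zonal_bound_one hk2 (by linarith) h0 h1 hγ₂ g hc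
  · have hk0 : (0 : ℝ) < k := by exact_mod_cast hk1
    refine exists_zonal_bound_of_one_lt hp1 ?_ ?_ h0 h1 hγ₂ fun h => hend ?_
    · rcases le_or_gt α₂ 0 with h | h
      · linarith
      · linarith [hp' h]
    · have hr : 0 < p - 1 := by linarith
      have hk1' : (1 : ℝ) ≤ k := by exact_mod_cast hk1
      rcases hkp with h | h
      · have : (2 : ℝ) ≤ k := by exact_mod_cast h
        have : 0 ≤ ((k : ℝ) - 2) / 2 * (p / (p - 1)) := by
          have : 0 ≤ (k : ℝ) - 2 := by linarith
          positivity
        linarith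
      -- For `p > 2` the conjugate exponent is below `2`, so even the exponent `-1/2` at `k = 1`
      -- stays integrable after raising to it.
      · have h3 : p / (p - 1) < 2 := by rw [div_lt_iff₀ hr]; linarith
        have h4 : 0 < p / (p - 1) := by positivity
        nlinarith
    · rw [div_eq_iff (by linarith)] at h
      rw [h]
      field_simp

/-! ### Necessity of the conditions on `γ₁` and `γ₂`: testing on intervals -/

lemma min_rpow_le_rpow {l u y : ℝ} (e : ℝ) (hl : 0 < l) (hy : l ≤ y) (hu : y ≤ u) :
    min (l ^ e) (u ^ e) ≤ y ^ e := by
  rcases le_total 0 e with he | he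
  · exact min_le_of_left_le (Real.rpow_le_rpow hl.le hy he)
  · exact min_le_of_right_le (Real.rpow_le_rpow_of_nonpos (hl.trans_le hy) hu he)

lemma rpow_le_max_mul_rpow {l u x y : ℝ} (e : ℝ) (hl : 0 < l) (hy : 0 < y) (h1 : l * y ≤ x)
    (h2 : x ≤ u * y) : x ^ e ≤ max (l ^ e) (u ^ e) * y ^ e := by
  have h3 : x = x / y * y := by field_simp
  have h4 : l ≤ x / y := (le_div_iff₀ hy).2 h1
  rw [h3, Real.mul_rpow (hl.le.trans h4) hy.le]
  gcongr
  exact rpow_le_max_rpow e hl h4 ((div_le_iff₀ hy).2 h2)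

lemma min_mul_rpow_le_rpow {l u x y : ℝ} (e : ℝ) (hl : 0 < l) (hy : 0 < y) (h1 : l * y ≤ x)
    (h2 : x ≤ u * y) : min (l ^ e) (u ^ e) * y ^ e ≤ x ^ e := by
  have h3 : x = x / y * y := by field_simp
  have h4 : l ≤ x / y := (le_div_iff₀ hy).2 h1
  rw [h3, Real.mul_rpow (hl.le.trans h4) hy.le]
  gcongr
  exact min_rpow_le_rpow e hl h4 ((div_le_iff₀ hy).2 h2)

/-- If `x < y`, then `ε^(x-y)` is unbounded as `ε → 0` and exceeds `K / A`. Each necessary condition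
is read off from such a comparison of powers. -/
lemma exponent_le_of_rpow_le {x y A K ε₀ : ℝ} (hA : 0 < A) (hε₀ : 0 < ε₀)
    (h : ∀ ε ∈ Ioo 0 ε₀, A * ε ^ x ≤ K * ε ^ y) : y ≤ x := by
  by_contra! hxy
  have ht := tendsto_rpow_neg_nhdsGT_zero (y := x - y) (by linarith)
  have h1 := ht.eventually_gt_atTop (K / A)
  have h2 : ∀ᶠ ε : ℝ in nhdsWithin 0 (Ioi 0), ε ∈ Ioo 0 ε₀ := Ioo_mem_nhdsGT hε₀
  obtain ⟨ε, h3, h4⟩ := (h1.and h2).exists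
  have h5 := h ε h4
  have h6 : ε ^ x = ε ^ (x - y) * ε ^ y := by rw [← Real.rpow_add h4.1, sub_add_cancel]
  rw [h6, ← mul_assoc] at h5
  have h7 := le_of_mul_le_mul_right h5 (Real.rpow_pos_of_pos h4.1 y)
  rw [div_lt_iff₀ hA, mul_comm] at h3
  linarith

lemma setLIntegral_le_zonalTransform {k : ℕ} {a b c : ℝ} (ha : 0 ≤ a) (hb : b ≤ c) (hc : 0 < c)
    (g : ℝ → ℝ≥0∞) :
    ∫⁻ u in Ioo a b, g u * ENNReal.ofReal ((1 - (u / c) ^ 2) ^ (((k : ℝ) - 2) / 2)) ≤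
      ENNReal.ofReal c * zonalTransform k c g := by
  have h := setLIntegral_comp_mul_left hc (a / c) (b / c)
    (fun u => g u * ENNReal.ofReal ((1 - (u / c) ^ 2) ^ (((k : ℝ) - 2) / 2)))
  rw [mul_div_cancel₀ _ hc.ne', mul_div_cancel₀ _ hc.ne'] at h
  rw [h]
  simp only [mul_div_cancel_left₀ _ hc.ne']
  refine mul_le_mul_right (lintegral_mono_set (Ioo_subset_Ioo ?_ ((div_le_one hc).2 hb))) _
  have : 0 ≤ a / c := by positivity
  linarith

/-- The zonal form of the bound, tested on non-negative functions. -/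
def ZonalTest (n k : ℕ) (p α₁ α₂ γ₁ γ₂ : ℝ) (K : ℝ≥0) : Prop :=
  ∀ g : ℝ → ℝ≥0, Measurable g → zonalNormPow n p α₁ α₂ (fun t => g t) ≠ ∞ →
    ∀ a b : ℝ, 0 ≤ a → a < b → b ≤ 1 → ∃ c ∈ Ioo a b,
      ENNReal.ofReal (√(1 - c ^ 2) ^ γ₁ * c ^ γ₂) * zonalTransform k c (fun t => g t) ≤
        K * zonalNormPow n p α₁ α₂ (fun t => g t) ^ (1 / p)

/-- The bound tested on the indicator of an interval. -/
lemma ZonalTest.interval {n k : ℕ} {p α₁ α₂ γ₁ γ₂ : ℝ} {K : ℝ≥0}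
    (h : ZonalTest n k p α₁ α₂ γ₁ γ₂ K) (hp : 0 < p) {a b c₀ c₁ m M : ℝ} (ha : 0 ≤ a) (hab : a < b)
    (hb : b ≤ c₀) (hc : c₀ < c₁) (hc₁ : c₁ ≤ 1) (hm : 0 ≤ m) (hM : 0 ≤ M)
    (hmle : ∀ c ∈ Ioo c₀ c₁, ∀ u ∈ Ioo a b, m ≤ (1 - (u / c) ^ 2) ^ (((k : ℝ) - 2) / 2))
    (hMle : ∀ t ∈ Ioo a b, (1 - t ^ 2) ^ ((α₁ + n - 2) / 2) * t ^ α₂ ≤ M) :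
    ∃ c ∈ Ioo c₀ c₁, (1 - c ^ 2) ^ (γ₁ / 2) * c ^ γ₂ * ((b - a) * m) ≤
      c * (K * ((b - a) * M) ^ (1 / p)) := by
  set g : ℝ → ℝ≥0 := (Ioo a b).indicator 1 with hg
  have hgm : Measurable g := measurable_one.indicator measurableSet_Ioo
  have hba : 0 < b - a := by linarith
  have hN : zonalNormPow n p α₁ α₂ (fun t => g t) ≤ ENNReal.ofReal ((b - a) * M) := by
    calc zonalNormPow n p α₁ α₂ (fun t => g t)
        ≤ ∫⁻ t in Ioo (-1 : ℝ) 1, (Ioo a b).indicator (fun _ => ENNReal.ofReal M) t := by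
          refine lintegral_mono fun t => ?_
          by_cases ht : t ∈ Ioo a b
          · simp only [hg, indicator_of_mem ht, Pi.one_apply, ENNReal.coe_one, ENNReal.one_rpow,
              one_mul]
            rw [abs_of_pos (ha.trans_lt ht.1)]
            exact ENNReal.ofReal_le_ofReal (hMle t ht)
          · simp [hg, indicator_of_notMem ht, hp]
      _ ≤ ∫⁻ t, (Ioo a b).indicator (fun _ => ENNReal.ofReal M) t := setLIntegral_le_lintegral _ _
      _ = ENNReal.ofReal ((b - a) * M) := by
          rw [lintegral_indicator measurableSet_Ioo, setLIntegral_const, Real.volume_Ioo, mul_comm,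
            ENNReal.ofReal_mul hba.le]
  obtain ⟨c, hcm, hle⟩ := h g hgm (ne_top_of_le_ne_top ENNReal.ofReal_ne_top hN) c₀ c₁
    (by linarith) hc hc₁
  have hc0 : 0 < c := by linarith [hcm.1]
  have hc1 : 0 < 1 - c ^ 2 := by nlinarith [hcm.2]
  refine ⟨c, hcm, ?_⟩
  -- The factor `c` is the Jacobian of `u = cs`, and it accounts for the `c` on the right of the
  -- conclusion.
  have hT : ENNReal.ofReal ((b - a) * m) ≤ ENNReal.ofReal c * zonalTransform k c (fun t => g t) := by
    refine le_trans ?_ (setLIntegral_le_zonalTransform ha (hb.trans hcm.1.le) hc0 _)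
    calc ENNReal.ofReal ((b - a) * m) = ∫⁻ u in Ioo a b, ENNReal.ofReal m := by
          rw [setLIntegral_const, Real.volume_Ioo, mul_comm, ENNReal.ofReal_mul hm]
      _ ≤ _ := by
          refine setLIntegral_mono' measurableSet_Ioo fun u hu => ?_
          simp only [hg, indicator_of_mem hu, Pi.one_apply, ENNReal.coe_one, one_mul]
          exact ENNReal.ofReal_le_ofReal (hmle c hcm u hu)
  have hσ : √(1 - c ^ 2) ^ γ₁ = (1 - c ^ 2) ^ (γ₁ / 2) := by
    rw [Real.sqrt_eq_rpow, ← Real.rpow_mul hc1.le]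
    ring_nf
  rw [hσ] at hle
  rw [← ENNReal.ofReal_le_ofReal_iff (by positivity), ENNReal.ofReal_mul (by positivity),
    ENNReal.ofReal_mul hc0.le, ENNReal.ofReal_mul (q := _ ^ (1 / p)) (by positivity),
    ENNReal.ofReal_coe_nnreal, ← ENNReal.ofReal_rpow_of_nonneg (by positivity) (by positivity)]
  calc ENNReal.ofReal ((1 - c ^ 2) ^ (γ₁ / 2) * c ^ γ₂) * ENNReal.ofReal ((b - a) * m)
      ≤ ENNReal.ofReal ((1 - c ^ 2) ^ (γ₁ / 2) * c ^ γ₂) *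
          (ENNReal.ofReal c * zonalTransform k c (fun t => g t)) := by gcongr
    _ = ENNReal.ofReal c * (ENNReal.ofReal ((1 - c ^ 2) ^ (γ₁ / 2) * c ^ γ₂) *
          zonalTransform k c (fun t => g t)) := by ring
    _ ≤ ENNReal.ofReal c * (K * zonalNormPow n p α₁ α₂ (fun t => g t) ^ (1 / p)) := by gcongr
    _ ≤ _ := by gcongr

/-- Near the equator everything scales with `ε`: for the indicator of `(ε/4, ε/2)` and `c ∈ (ε, 2ε)`
the transform is bounded below by a positive constant, the weight is of order `ε^γ₂`, and the norm
is at most of order `ε^((1+α₂)/p)`. -/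
lemma ZonalTest.le_gamma_two {n k : ℕ} {p α₁ α₂ γ₁ γ₂ : ℝ} {K : ℝ≥0}
    (h : ZonalTest n k p α₁ α₂ γ₁ γ₂ K) (hp : 0 < p) : (1 + α₂) / p ≤ γ₂ := by
  set e : ℝ := ((k : ℝ) - 2) / 2
  set f : ℝ := (α₁ + n - 2) / 2
  set m : ℝ := min ((3 / 4 : ℝ) ^ e) (1 ^ e) with hm
  set M : ℝ := max ((3 / 4 : ℝ) ^ f) (1 ^ f) * max ((1 / 4 : ℝ) ^ α₂) ((1 / 2) ^ α₂) with hM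
  have hm0 : 0 < m := by positivity
  have hM0 : 0 < M := by positivity
  refine exponent_le_of_rpow_le (ε₀ := 1 / 4)
    (A := min ((3 / 4 : ℝ) ^ (γ₁ / 2)) (1 ^ (γ₁ / 2)) * min (1 ^ γ₂) ((2 : ℝ) ^ γ₂) * (1 / 8 * m))
    (K := K * (1 / 4 * M) ^ (1 / p)) (by positivity) (by norm_num) fun ε hε => ?_
  have hε0 := hε.1
  have hε1 := hε.2
  obtain ⟨c, hc, hle⟩ := h.interval hp (a := ε / 4) (b := ε / 2) (c₀ := ε) (c₁ := 2 * ε) (m := m)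
    (M := M * ε ^ α₂) (by linarith) (by linarith) (by linarith) (by linarith) (by linarith)
    hm0.le (by positivity) (fun c hc u hu => by
      have hc0 : 0 < c := hε0.trans hc.1
      have h1 : u / c ≤ 1 / 2 := by rw [div_le_iff₀ hc0]; linarith [hu.2, hc.1]
      have h2 : 0 ≤ u / c := div_nonneg (by linarith [hu.1]) hc0.le
      exact min_rpow_le_rpow e (by norm_num) (by nlinarith) (by nlinarith)) (fun t ht => by
      have h1 : 0 < t := by linarith [ht.1]
      have h2 : t ≤ 1 / 2 := by linarith [ht.2]
      have h3 : (1 - t ^ 2) ^ f ≤ max ((3 / 4 : ℝ) ^ f) (1 ^ f) :=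
        rpow_le_max_rpow f (by norm_num) (by nlinarith) (by nlinarith)
      have h4 : t ^ α₂ ≤ max ((1 / 4 : ℝ) ^ α₂) ((1 / 2) ^ α₂) * ε ^ α₂ :=
        rpow_le_max_mul_rpow α₂ (by norm_num) hε0 (by linarith [ht.1]) (by linarith [ht.2])
      rw [hM, mul_assoc]
      gcongr)
  have hc0 : 0 < c := hε0.trans hc.1
  have hc2 : c ≤ 1 / 2 := by linarith [hc.2]
  have h1 : min ((3 / 4 : ℝ) ^ (γ₁ / 2)) (1 ^ (γ₁ / 2)) ≤ (1 - c ^ 2) ^ (γ₁ / 2) :=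
    min_rpow_le_rpow _ (by norm_num) (by nlinarith) (by nlinarith)
  have h2 : min (1 ^ γ₂) ((2 : ℝ) ^ γ₂) * ε ^ γ₂ ≤ c ^ γ₂ :=
    min_mul_rpow_le_rpow _ one_pos hε0 (by linarith [hc.1]) hc.2.le
  have h3 : c * (1 / 8 * m) ≤ (ε / 2 - ε / 4) * m := by
    rw [← mul_assoc]
    gcongr
    linarith [hc.2]
  have h4 : ((ε / 2 - ε / 4) * (M * ε ^ α₂)) ^ (1 / p) =
      (1 / 4 * M) ^ (1 / p) * ε ^ ((1 + α₂) / p) := by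
    rw [show (ε / 2 - ε / 4) * (M * ε ^ α₂) = (1 / 4 * M) * (ε ^ (1 : ℝ) * ε ^ α₂) by
      rw [Real.rpow_one]; ring, ← Real.rpow_add hε0, Real.mul_rpow (by positivity) (by positivity),
      ← Real.rpow_mul hε0.le, mul_one_div]
  rw [h4] at hle
  have h5 : c * (min ((3 / 4 : ℝ) ^ (γ₁ / 2)) (1 ^ (γ₁ / 2)) * min (1 ^ γ₂) ((2 : ℝ) ^ γ₂) *
      (1 / 8 * m) * ε ^ γ₂) ≤ c * (K * (1 / 4 * M) ^ (1 / p) * ε ^ ((1 + α₂) / p)) := by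
    calc _ = min ((3 / 4 : ℝ) ^ (γ₁ / 2)) (1 ^ (γ₁ / 2)) * (min (1 ^ γ₂) ((2 : ℝ) ^ γ₂) * ε ^ γ₂) *
          (c * (1 / 8 * m)) := by ring
      _ ≤ (1 - c ^ 2) ^ (γ₁ / 2) * c ^ γ₂ * ((ε / 2 - ε / 4) * m) := by
          have : 0 ≤ 1 - c ^ 2 := by nlinarith
          gcongr
      _ ≤ _ := hle
      _ = _ := by ring
  exact le_of_mul_le_mul_left h5 hc0

/-- A fixed function supported away from the pole has a transform bounded below as `c → 1`, so the
weight `(1-c²)^(γ₁/2)` must not blow up. -/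
lemma ZonalTest.gamma_one_nonneg {n k : ℕ} {p α₁ α₂ γ₁ γ₂ : ℝ} {K : ℝ≥0}
    (h : ZonalTest n k p α₁ α₂ γ₁ γ₂ K) (hp : 0 < p) : 0 ≤ γ₁ := by
  set e : ℝ := ((k : ℝ) - 2) / 2
  set f : ℝ := (α₁ + n - 2) / 2
  set m : ℝ := min ((1 / 2 : ℝ) ^ e) (1 ^ e) with hm
  set M : ℝ := max ((3 / 4 : ℝ) ^ f) (1 ^ f) * max ((1 / 4 : ℝ) ^ α₂) ((1 / 2) ^ α₂) with hM
  have hm0 : 0 < m := by positivity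
  have hM0 : 0 < M := by positivity
  suffices 0 ≤ γ₁ / 2 by linarith
  refine exponent_le_of_rpow_le (ε₀ := 1 / 8)
    (A := min (1 ^ (γ₁ / 2)) ((4 : ℝ) ^ (γ₁ / 2)) * min ((3 / 4 : ℝ) ^ γ₂) (1 ^ γ₂) * (1 / 4 * m))
    (K := K * (1 / 4 * M) ^ (1 / p)) (by positivity) (by norm_num) fun ε hε => ?_
  have hε0 := hε.1
  have hε1 := hε.2
  obtain ⟨c, hc, hle⟩ := h.interval hp (a := 1 / 4) (b := 1 / 2) (c₀ := 1 - 2 * ε) (c₁ := 1 - ε)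
    (m := m) (M := M) (by linarith) (by linarith) (by linarith) (by linarith) (by linarith)
    hm0.le hM0.le (fun c hc u hu => by
      have hc0 : 3 / 4 < c := by linarith [hc.1]
      have h1 : u / c ≤ 2 / 3 := by rw [div_le_iff₀ (by linarith)]; linarith [hu.2, hc.1]
      have h2 : 0 ≤ u / c := div_nonneg (by linarith [hu.1]) (by linarith)
      exact min_rpow_le_rpow e (by norm_num) (by nlinarith) (by nlinarith)) (fun t ht => by
      have h1 : 0 < t := by linarith [ht.1]
      have h2 : t ≤ 1 / 2 := by linarith [ht.2]
      have h3 : (1 - t ^ 2) ^ f ≤ max ((3 / 4 : ℝ) ^ f) (1 ^ f) :=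
        rpow_le_max_rpow f (by norm_num) (by nlinarith) (by nlinarith)
      have h4 : t ^ α₂ ≤ max ((1 / 4 : ℝ) ^ α₂) ((1 / 2) ^ α₂) :=
        rpow_le_max_rpow α₂ (by norm_num) ht.1.le h2
      rw [hM]
      gcongr)
  have hc0 : 3 / 4 < c := by linarith [hc.1]
  have hc1 : c < 1 := by linarith [hc.2]
  have h1 : min (1 ^ (γ₁ / 2)) ((4 : ℝ) ^ (γ₁ / 2)) * ε ^ (γ₁ / 2) ≤ (1 - c ^ 2) ^ (γ₁ / 2) :=
    min_mul_rpow_le_rpow _ one_pos hε0 (by nlinarith [hc.2]) (by nlinarith [hc.1])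
  have h2 : min ((3 / 4 : ℝ) ^ γ₂) (1 ^ γ₂) ≤ c ^ γ₂ :=
    min_rpow_le_rpow _ (by norm_num) hc0.le hc1.le
  have h6 : 0 ≤ 1 - c ^ 2 := by nlinarith
  calc _ = min (1 ^ (γ₁ / 2)) ((4 : ℝ) ^ (γ₁ / 2)) * ε ^ (γ₁ / 2) *
          min ((3 / 4 : ℝ) ^ γ₂) (1 ^ γ₂) * (1 / 4 * m) := by ring
    _ ≤ (1 - c ^ 2) ^ (γ₁ / 2) * c ^ γ₂ * (1 / 4 * m) := by gcongr
    _ = (1 - c ^ 2) ^ (γ₁ / 2) * c ^ γ₂ * ((1 / 2 - 1 / 4) * m) := by ring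
    _ ≤ c * (K * ((1 / 2 - 1 / 4) * M) ^ (1 / p)) := hle
    _ ≤ 1 * (K * ((1 / 2 - 1 / 4) * M) ^ (1 / p)) := by
        have : 0 ≤ (1 / 2 - 1 / 4) * M := by positivity
        gcongr
    _ = _ := by rw [Real.rpow_zero]; norm_num

/-- Concentration at the pole: take the indicator of `(1-8ε, 1-4ε)` and `c ∈ (1-2ε, 1-ε)`. Then
`1-c²`, `1-t²` and `1-(u/c)²` are all comparable to `ε`, so the left side is at least of order
`ε^(γ₁/2 + k/2)` and the norm at most of order `ε^((α₁+n)/(2p))`. -/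
lemma ZonalTest.le_gamma_one {n k : ℕ} {p α₁ α₂ γ₁ γ₂ : ℝ} {K : ℝ≥0}
    (h : ZonalTest n k p α₁ α₂ γ₁ γ₂ K) (hp : 0 < p) : (α₁ + n) / p - k ≤ γ₁ := by
  set e : ℝ := ((k : ℝ) - 2) / 2 with he
  set f : ℝ := (α₁ + n - 2) / 2 with hf
  set m : ℝ := min ((2 : ℝ) ^ e) (20 ^ e) with hm
  set M : ℝ := max ((4 : ℝ) ^ f) (16 ^ f) * max ((1 / 2 : ℝ) ^ α₂) (1 ^ α₂) with hM
  have hm0 : 0 < m := by positivity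
  have hM0 : 0 < M := by positivity
  suffices (1 + f) / p ≤ γ₁ / 2 + 1 + e by
    have h1 : (1 + f) / p = (α₁ + n) / p / 2 := by rw [hf]; ring
    rw [h1, he] at this
    linarith
  refine exponent_le_of_rpow_le (ε₀ := 1 / 16)
    (A := min (1 ^ (γ₁ / 2)) ((4 : ℝ) ^ (γ₁ / 2)) * min ((3 / 4 : ℝ) ^ γ₂) (1 ^ γ₂) * (4 * m))
    (K := K * (4 * M) ^ (1 / p)) (by positivity) (by norm_num) fun ε hε => ?_
  have hε0 := hε.1
  have hε1 := hε.2
  obtain ⟨c, hc, hle⟩ := h.interval hp (a := 1 - 8 * ε) (b := 1 - 4 * ε) (c₀ := 1 - 2 * ε)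
    (c₁ := 1 - ε) (m := m * ε ^ e) (M := M * ε ^ f) (by linarith) (by linarith) (by linarith)
    -- The gap between the support and the range of `c` keeps `c-u` in `[2ε, 7ε]`; hence the
    -- constants `2` and `20` in `m`.
    (by linarith) (by linarith) (by positivity) (by positivity) (fun c hc u hu => by
      have hc0 : 7 / 8 < c := by linarith [hc.1]
      have hc1 : c < 1 := by linarith [hc.2]
      have h1 : 1 - (u / c) ^ 2 = (c - u) * (c + u) / c ^ 2 := by field_simp; ring
      have h2 : 2 * ε ≤ c - u := by linarith [hc.1, hu.2]
      have h3 : c - u ≤ 7 * ε := by linarith [hc.2, hu.1]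
      have h4 : 1 ≤ c + u := by linarith [hu.1]
      have h5 : c + u ≤ 2 := by linarith [hu.2]
      have hc2 : 0 < c ^ 2 := by positivity
      refine min_mul_rpow_le_rpow e two_pos hε0 ?_ ?_
      · rw [h1, le_div_iff₀ hc2]
        have hc3 : c ^ 2 ≤ 1 := by nlinarith
        calc 2 * ε * c ^ 2 ≤ (c - u) * 1 := by nlinarith [mul_le_mul_of_nonneg_left hc3 hε0.le]
          _ ≤ _ := by gcongr; linarith
      · rw [h1, div_le_iff₀ hc2]
        calc (c - u) * (c + u) ≤ 7 * ε * 2 := by gcongr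
          _ ≤ 20 * ε * c ^ 2 := by
            have : 49 / 64 ≤ c ^ 2 := by nlinarith
            nlinarith) (fun t ht => by
      have h1 : 1 / 2 < t := by linarith [ht.1]
      have h2 : t < 1 := by linarith [ht.2]
      have h3 : (1 - t ^ 2) ^ f ≤ max ((4 : ℝ) ^ f) (16 ^ f) * ε ^ f :=
        rpow_le_max_mul_rpow f (by norm_num) hε0 (by nlinarith [ht.2]) (by nlinarith [ht.1])
      have h4 : t ^ α₂ ≤ max ((1 / 2 : ℝ) ^ α₂) (1 ^ α₂) :=
        rpow_le_max_rpow α₂ (by norm_num) h1.le h2.le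
      rw [hM, mul_right_comm]
      gcongr)
  have hc0 : 3 / 4 < c := by linarith [hc.1]
  have hc1 : c < 1 := by linarith [hc.2]
  have h1 : min (1 ^ (γ₁ / 2)) ((4 : ℝ) ^ (γ₁ / 2)) * ε ^ (γ₁ / 2) ≤ (1 - c ^ 2) ^ (γ₁ / 2) :=
    min_mul_rpow_le_rpow _ one_pos hε0 (by nlinarith [hc.2]) (by nlinarith [hc.1])
  have h2 : min ((3 / 4 : ℝ) ^ γ₂) (1 ^ γ₂) ≤ c ^ γ₂ :=
    min_rpow_le_rpow _ (by norm_num) hc0.le hc1.le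
  have h6 : 0 ≤ 1 - c ^ 2 := by nlinarith
  have h7 : 1 - 4 * ε - (1 - 8 * ε) = 4 * ε := by ring
  have h4 : (4 * ε * (M * ε ^ f)) ^ (1 / p) = (4 * M) ^ (1 / p) * ε ^ ((1 + f) / p) := by
    rw [show 4 * ε * (M * ε ^ f) = (4 * M) * (ε ^ (1 : ℝ) * ε ^ f) by
      rw [Real.rpow_one]; ring, ← Real.rpow_add hε0, Real.mul_rpow (by positivity) (by positivity),
      ← Real.rpow_mul hε0.le, mul_one_div]
  rw [h7, h4] at hle
  calc _ = min (1 ^ (γ₁ / 2)) ((4 : ℝ) ^ (γ₁ / 2)) * ε ^ (γ₁ / 2) *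
          min ((3 / 4 : ℝ) ^ γ₂) (1 ^ γ₂) * (4 * ε * (m * ε ^ e)) := by
        rw [Real.rpow_add hε0, Real.rpow_add hε0, Real.rpow_one]
        ring
    _ ≤ (1 - c ^ 2) ^ (γ₁ / 2) * c ^ γ₂ * (4 * ε * (m * ε ^ e)) := by gcongr
    _ ≤ c * (K * ((4 * M) ^ (1 / p) * ε ^ ((1 + f) / p))) := hle
    _ ≤ 1 * (K * ((4 * M) ^ (1 / p) * ε ^ ((1 + f) / p))) := by gcongr
    _ = _ := by ring

/-! ### Necessity of `p > 2` for `k = 1`: a logarithmic divergence -/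

/-- A linear majorant in place of Jensen's inequality for the concave power `p/2 ≤ 1`. When `x` has
integral `L`, integrating it over a bounded interval gives a bound of order `L^(p/2)`, for all `p ≤
2` at once. -/
lemma rpow_half_le_of_le_two {x L p : ℝ} (hx : 0 ≤ x) (hL : 0 < L) (hp : 0 < p) (hp2 : p ≤ 2) :
    x ^ (p / 2) ≤ L ^ (p / 2) * (1 + x / L) := by
  have h1 : x ^ (p / 2) = L ^ (p / 2) * (x / L) ^ (p / 2) := by
    rw [← Real.mul_rpow hL.le (by positivity), mul_div_cancel₀ _ hL.ne']
  rw [h1]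
  gcongr
  have h2 : 0 ≤ x / L := by positivity
  rcases le_total (x / L) 1 with h | h
  · linarith [Real.rpow_le_one h2 h (by positivity : 0 ≤ p / 2)]
  · have := Real.rpow_le_rpow_of_exponent_le h (by linarith : p / 2 ≤ 1)
    rw [Real.rpow_one] at this
    linarith

lemma setLIntegral_inv_sub {ε : ℝ} (hε : 0 < ε) :
    ∫⁻ u in Ioo (1 / 4 : ℝ) (1 / 2), ENNReal.ofReal ((1 / 2 + ε - u)⁻¹) =
      ENNReal.ofReal (Real.log ((1 / 4 + ε) / ε)) := by
  have hcont : ContinuousOn (fun u : ℝ => (1 / 2 + ε - u)⁻¹) (Icc (1 / 4) (1 / 2)) :=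
    ContinuousOn.inv₀ (by fun_prop) fun u hu => by linarith [hu.2]
  have hint : IntegrableOn (fun u : ℝ => (1 / 2 + ε - u)⁻¹) (Ioo (1 / 4) (1 / 2)) :=
    hcont.integrableOn_Icc.mono_set Ioo_subset_Icc_self
  rw [← ofReal_integral_eq_lintegral_ofReal hint]
  · congr 1
    rw [← integral_Ioc_eq_integral_Ioo, ← intervalIntegral.integral_of_le (by norm_num),
      intervalIntegral.integral_comp_sub_left (fun x => x⁻¹),
      integral_inv_of_pos (by linarith) (by linarith)]
    congr 2 <;> ring
  · filter_upwards [ae_restrict_mem measurableSet_Ioo] with u hu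
    exact inv_nonneg.2 (by linarith [hu.2])

/-- For `k = 1` the kernel is `(1-(u/c)²)^(-1/2)`, singular at `u = c`. Testing with
`(1/2+ε-t)^(-1/2)` for `c ∈ (1/2, 1/2+ε)` doubles the singularity to `(1/2+ε-u)^(-1)`, whose
integral is `L`, while the norm is at most of order `L^(1/2)`. Since `c` stays between `1/2` and
`3/4`, the weights are harmless. -/
lemma ZonalTest.two_lt {n : ℕ} {p α₁ α₂ γ₁ γ₂ : ℝ} {K : ℝ≥0}
    (h : ZonalTest n 1 p α₁ α₂ γ₁ γ₂ K) (hp : 0 < p) : 2 < p := by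
  by_contra! hp2
  set f : ℝ := (α₁ + n - 2) / 2 with hf
  set M : ℝ := max ((3 / 4 : ℝ) ^ f) (1 ^ f) * max ((1 / 4 : ℝ) ^ α₂) ((1 / 2) ^ α₂) with hM
  set A : ℝ := min ((7 / 16 : ℝ) ^ (γ₁ / 2)) (1 ^ (γ₁ / 2)) * min ((1 / 2 : ℝ) ^ γ₂) (1 ^ γ₂) *
    8 ^ (-(1 / 2) : ℝ) with hA
  have hM0 : 0 < M := by positivity
  have hA0 : 0 < A := by positivity
  have key : ∀ ε ∈ Ioo (0 : ℝ) (1 / 4), 1 ≤ Real.log ((1 / 4 + ε) / ε) →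
      A * Real.log ((1 / 4 + ε) / ε) ≤
        K * (2 * M) ^ (1 / p) * Real.log ((1 / 4 + ε) / ε) ^ (1 / 2 : ℝ) := by
    intro ε hε hL1
    have hε0 := hε.1
    set L := Real.log ((1 / 4 + ε) / ε) with hL
    have hL0 : 0 < L := by linarith
    have hLint := setLIntegral_inv_sub hε0
    rw [← hL] at hLint
    set g : ℝ → ℝ≥0 := (Ioo (1 / 4 : ℝ) (1 / 2)).indicator
      fun t => ((1 / 2 + ε - t)⁻¹ ^ (1 / 2 : ℝ)).toNNReal with hg
    have hgm : Measurable g := by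
      refine Measurable.indicator ?_ measurableSet_Ioo
      fun_prop
    have hgt : ∀ t ∈ Ioo (1 / 4 : ℝ) (1 / 2),
        (g t : ℝ≥0∞) = ENNReal.ofReal ((1 / 2 + ε - t)⁻¹ ^ (1 / 2 : ℝ)) := fun t ht => by
      rw [hg, indicator_of_mem ht]
      rfl
    have hw : ∀ t ∈ Ioo (1 / 4 : ℝ) (1 / 2), 0 < (1 / 2 + ε - t)⁻¹ := fun t ht =>
      inv_pos.2 (by linarith [ht.2])
    have hN : zonalNormPow n p α₁ α₂ (fun t => g t) ≤ ENNReal.ofReal (L ^ (p / 2) * (2 * M)) := by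
      calc zonalNormPow n p α₁ α₂ (fun t => g t)
          ≤ ∫⁻ t in Ioo (-1 : ℝ) 1, (Ioo (1 / 4 : ℝ) (1 / 2)).indicator (fun t =>
              ENNReal.ofReal (L ^ (p / 2) * M) *
                (1 + ENNReal.ofReal L⁻¹ * ENNReal.ofReal (1 / 2 + ε - t)⁻¹)) t := by
            refine lintegral_mono fun t => ?_
            by_cases ht : t ∈ Ioo (1 / 4 : ℝ) (1 / 2)
            · have h1 : 0 < t := by linarith [ht.1]
              have h0 := hw t ht
              have h3 : (1 - t ^ 2) ^ f ≤ max ((3 / 4 : ℝ) ^ f) (1 ^ f) :=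
                rpow_le_max_rpow f (by norm_num) (by nlinarith [ht.2]) (by nlinarith)
              have h4 : t ^ α₂ ≤ max ((1 / 4 : ℝ) ^ α₂) ((1 / 2) ^ α₂) :=
                rpow_le_max_rpow α₂ (by norm_num) ht.1.le ht.2.le
              have h5 : (1 - t ^ 2) ^ f * t ^ α₂ ≤ M := by
                rw [hM]
                gcongr
              have h6 := rpow_half_le_of_le_two h0.le hL0 hp hp2
              have h7 : 0 ≤ (1 - t ^ 2) ^ f :=
                Real.rpow_nonneg (by nlinarith [ht.2]) _
              beta_reduce
              rw [indicator_of_mem ht, hgt t ht, abs_of_pos h1,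
                ENNReal.ofReal_rpow_of_nonneg (by positivity) hp.le, ← Real.rpow_mul h0.le,
                ← ENNReal.ofReal_mul (by positivity), ← ENNReal.ofReal_mul (by positivity),
                ← ENNReal.ofReal_one, ← ENNReal.ofReal_add zero_le_one (by positivity),
                ← ENNReal.ofReal_mul (by positivity)]
              refine ENNReal.ofReal_le_ofReal ?_
              rw [one_div_mul_eq_div]
              calc (1 / 2 + ε - t)⁻¹ ^ (p / 2) * ((1 - t ^ 2) ^ f * t ^ α₂)
                  ≤ (L ^ (p / 2) * (1 + (1 / 2 + ε - t)⁻¹ / L)) * M := by gcongr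
                _ = _ := by ring
            · have h0 : g t = 0 := indicator_of_notMem ht _
              rw [indicator_of_notMem ht]
              simp [h0, hp]
        _ ≤ ∫⁻ t, (Ioo (1 / 4 : ℝ) (1 / 2)).indicator (fun t =>
              ENNReal.ofReal (L ^ (p / 2) * M) *
                (1 + ENNReal.ofReal L⁻¹ * ENNReal.ofReal (1 / 2 + ε - t)⁻¹)) t :=
            setLIntegral_le_lintegral _ _
        _ = ENNReal.ofReal (L ^ (p / 2) * M) * (ENNReal.ofReal (1 / 4) + 1) := by
            rw [lintegral_indicator measurableSet_Ioo,
              lintegral_const_mul' _ _ ENNReal.ofReal_ne_top, lintegral_add_left measurable_const,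
              lintegral_const_mul' _ _ ENNReal.ofReal_ne_top, hLint,
              ← ENNReal.ofReal_mul (by positivity), inv_mul_cancel₀ hL0.ne', setLIntegral_const,
              Real.volume_Ioo, ENNReal.ofReal_one, one_mul]
            norm_num
        _ ≤ ENNReal.ofReal (L ^ (p / 2) * M) * ENNReal.ofReal 2 := by
            gcongr
            rw [← ENNReal.ofReal_one, ← ENNReal.ofReal_add (by norm_num) zero_le_one]
            exact ENNReal.ofReal_le_ofReal (by norm_num)
        _ = _ := by
            rw [← ENNReal.ofReal_mul (by positivity)]
            ring_nf
    obtain ⟨c, hc, hle⟩ := h g hgm (ne_top_of_le_ne_top ENNReal.ofReal_ne_top hN) (1 / 2)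
      (1 / 2 + ε) (by norm_num) (by linarith) (by linarith [hε.2])
    have hc0 : 1 / 2 < c := hc.1
    have hc1 : c < 3 / 4 := by linarith [hc.2, hε.2]
    have hc2 : 0 < 1 - c ^ 2 := by nlinarith
    have hT : ENNReal.ofReal (8 ^ (-(1 / 2) : ℝ) * L) ≤ zonalTransform 1 c (fun t => g t) := by
      calc ENNReal.ofReal (8 ^ (-(1 / 2) : ℝ) * L)
          = ∫⁻ u in Ioo (1 / 4 : ℝ) (1 / 2),
              ENNReal.ofReal (8 ^ (-(1 / 2) : ℝ)) * ENNReal.ofReal (1 / 2 + ε - u)⁻¹ := by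
            rw [lintegral_const_mul' _ _ ENNReal.ofReal_ne_top, hLint, ENNReal.ofReal_mul
              (by positivity)]
        _ ≤ ∫⁻ u in Ioo (1 / 4 : ℝ) (1 / 2), (g u : ℝ≥0∞) *
              ENNReal.ofReal ((1 - (u / c) ^ 2) ^ ((((1 : ℕ) : ℝ) - 2) / 2)) := by
            refine setLIntegral_mono' measurableSet_Ioo fun u hu => ?_
            have h0 := hw u hu
            have hw0 : 0 < 1 / 2 + ε - u := inv_pos.1 h0
            rw [hgt u hu, ← ENNReal.ofReal_mul (by positivity), ← ENNReal.ofReal_mul (by positivity)]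
            refine ENNReal.ofReal_le_ofReal ?_
            have h1 : 1 - (u / c) ^ 2 = (c - u) * (c + u) / c ^ 2 := by field_simp; ring
            have h2 : 0 < c - u := by linarith [hu.2]
            have h3 : 0 < c + u := by linarith [hu.1]
            -- The constant is `2 / (1/4)`, from `c+u ≤ 2` and `c² ≥ 1/4`.
            have h4 : 1 - (u / c) ^ 2 ≤ 8 * (1 / 2 + ε - u) := by
              rw [h1, div_le_iff₀ (by positivity)]
              calc (c - u) * (c + u) ≤ (1 / 2 + ε - u) * 2 := by
                    gcongr
                    · exact hc.2.le
                    · linarith [hu.2]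
                _ ≤ _ := by
                    have : 1 / 4 ≤ c ^ 2 := by nlinarith
                    nlinarith
            have h5 : (8 * (1 / 2 + ε - u)) ^ (-(1 / 2) : ℝ) ≤ (1 - (u / c) ^ 2) ^ (-(1 / 2) : ℝ) :=
              Real.rpow_le_rpow_of_nonpos (by rw [h1]; positivity) h4 (by norm_num)
            rw [Real.mul_rpow (by norm_num) hw0.le, Real.rpow_neg hw0.le,
              ← Real.inv_rpow hw0.le] at h5
            have h6 : (((1 : ℕ) : ℝ) - 2) / 2 = -(1 / 2) := by norm_num
            have h7 : (1 / 2 + ε - u)⁻¹ =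
                (1 / 2 + ε - u)⁻¹ ^ (1 / 2 : ℝ) * (1 / 2 + ε - u)⁻¹ ^ (1 / 2 : ℝ) := by
              rw [← Real.rpow_add h0]
              norm_num
            rw [h6]
            calc 8 ^ (-(1 / 2) : ℝ) * (1 / 2 + ε - u)⁻¹
                = (1 / 2 + ε - u)⁻¹ ^ (1 / 2 : ℝ) *
                  (8 ^ (-(1 / 2) : ℝ) * (1 / 2 + ε - u)⁻¹ ^ (1 / 2 : ℝ)) := by
                  conv_lhs => rw [h7]
                  ring
              _ ≤ _ := by gcongr
        _ ≤ ENNReal.ofReal c * zonalTransform 1 c (fun t => g t) :=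
            setLIntegral_le_zonalTransform (by norm_num) hc0.le (by linarith) _
        _ ≤ 1 * zonalTransform 1 c (fun t => g t) := by
            gcongr
            exact ENNReal.ofReal_le_one.2 (by linarith)
        _ = _ := one_mul _
    have hσ : √(1 - c ^ 2) ^ γ₁ = (1 - c ^ 2) ^ (γ₁ / 2) := by
      rw [Real.sqrt_eq_rpow, ← Real.rpow_mul hc2.le]
      ring_nf
    have h1 : min ((7 / 16 : ℝ) ^ (γ₁ / 2)) (1 ^ (γ₁ / 2)) ≤ √(1 - c ^ 2) ^ γ₁ := by
      rw [hσ]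
      exact min_rpow_le_rpow _ (by norm_num) (by nlinarith) (by nlinarith)
    have h2 : min ((1 / 2 : ℝ) ^ γ₂) (1 ^ γ₂) ≤ c ^ γ₂ :=
      min_rpow_le_rpow _ (by norm_num) hc0.le (by linarith)
    rw [← ENNReal.ofReal_le_ofReal_iff (by positivity)]
    calc ENNReal.ofReal (A * L) = ENNReal.ofReal (min ((7 / 16 : ℝ) ^ (γ₁ / 2)) (1 ^ (γ₁ / 2)) *
          min ((1 / 2 : ℝ) ^ γ₂) (1 ^ γ₂)) * ENNReal.ofReal (8 ^ (-(1 / 2) : ℝ) * L) := by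
          rw [← ENNReal.ofReal_mul (by positivity), hA]
          ring_nf
      _ ≤ ENNReal.ofReal (√(1 - c ^ 2) ^ γ₁ * c ^ γ₂) * zonalTransform 1 c (fun t => g t) := by
          gcongr
      _ ≤ K * zonalNormPow n p α₁ α₂ (fun t => g t) ^ (1 / p) := hle
      _ ≤ K * ENNReal.ofReal (L ^ (p / 2) * (2 * M)) ^ (1 / p) := by gcongr
      _ = _ := by
          rw [ENNReal.ofReal_rpow_of_nonneg (by positivity) (by positivity),
            Real.mul_rpow (by positivity) (by positivity), ← Real.rpow_mul hL0.le,
            show p / 2 * (1 / p) = 1 / 2 by field_simp, mul_assoc, ENNReal.ofReal_mul K.coe_nonneg,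
            ENNReal.ofReal_coe_nnreal, mul_comm (L ^ _)]
  -- The test inequality says `L^(1/2) ≤ R`, that is `L ≤ R²`. The choice `ε = exp(-X)/4` forces `L
  -- ≥ X = 1 + R²`, a contradiction.
  set R : ℝ := K * (2 * M) ^ (1 / p) / A with hR
  have hR0 : 0 ≤ R := by positivity
  set X : ℝ := 1 + R ^ 2 with hX
  set ε : ℝ := Real.exp (-X) / 4 with hε
  have hε0 : 0 < ε := by positivity
  have hε1 : ε < 1 / 4 := by
    have : Real.exp (-X) < 1 := Real.exp_lt_one_iff.2 (by nlinarith)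
    linarith
  have hXL : X ≤ Real.log ((1 / 4 + ε) / ε) := by
    rw [Real.le_log_iff_exp_le (by positivity), le_div_iff₀ hε0, hε, Real.exp_neg]
    field_simp
    linarith [Real.exp_pos X]
  have h1 := key ε ⟨hε0, hε1⟩ (by nlinarith)
  set L := Real.log ((1 / 4 + ε) / ε)
  have hL0 : 0 < L := by nlinarith
  have h2 : L = L ^ (1 / 2 : ℝ) * L ^ (1 / 2 : ℝ) := by
    rw [← Real.rpow_add hL0]
    norm_num
  have h3 : 0 < L ^ (1 / 2 : ℝ) := by positivity
  have h4 : L ^ (1 / 2 : ℝ) ≤ R := by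
    rw [hR, le_div_iff₀ hA0, mul_comm]
    refine le_of_mul_le_mul_right ?_ h3
    calc A * L ^ (1 / 2 : ℝ) * L ^ (1 / 2 : ℝ) = A * L := by rw [mul_assoc, ← h2]
      _ ≤ _ := h1
  nlinarith

end KPlane

theorem mainTheorem6 (n k : ℕ) (hk1 : 1 ≤ k) (hkn : k < n) (α₁ α₂ γ₁ γ₂ p : ℝ)
    (hp : max 1 (1 + α₂) ≤ p) (hp' : 0 < α₂ → 1 + α₂ < p)
    (hend : p = (α₁ + n) / k → 0 < γ₁) :
    (2 ≤ k →
      (KPlane.RadialBound hkn p α₁ α₂ γ₁ γ₂ ↔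
        max 0 ((α₁ + n) / p - k) ≤ γ₁ ∧ (1 + α₂) / p ≤ γ₂)) ∧
    (k = 1 →
      (KPlane.RadialBound hkn p α₁ α₂ γ₁ γ₂ ↔
        (max 0 ((α₁ + n) / p - k) ≤ γ₁ ∧ (1 + α₂) / p ≤ γ₂) ∧ 2 < p)) := by
  have hp0 : 0 < p := one_pos.trans_le ((le_max_left _ _).trans hp)
  have necessary : KPlane.RadialBound hkn p α₁ α₂ γ₁ γ₂ →
      max 0 ((α₁ + n) / p - k) ≤ γ₁ ∧ (1 + α₂) / p ≤ γ₂ := fun h => by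
    obtain ⟨K, hK⟩ := h.zonal hk1 hkn hp0
    have hK : KPlane.ZonalTest n k p α₁ α₂ γ₁ γ₂ K := hK
    exact ⟨max_le (hK.gamma_one_nonneg hp0) (hK.le_gamma_one hp0), hK.le_gamma_two hp0⟩
  refine ⟨fun hk => ⟨necessary, fun h => ?_⟩, fun hk => ⟨fun h => ⟨necessary h, ?_⟩, fun h => ?_⟩⟩
  · exact KPlane.radialBound_of_exponents hk1 hkn hp hp' hend h.1 h.2 (Or.inl hk)
  · obtain ⟨K, hK⟩ := h.zonal hk1 hkn hp0
    subst hk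
    have hK : KPlane.ZonalTest n 1 p α₁ α₂ γ₁ γ₂ K := hK
    exact hK.two_lt hp0
  · exact KPlane.radialBound_of_exponents hk1 hkn hp hp' hend h.1.1 h.1.2 (Or.inr h.2)
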